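/- Let $k$ be a field of characteristic zero, let $\Omega=\bigcup_{m\ge 1}\Omega_m$ be a well-ordered set of operators, where the elements of $\Omega_m$ are $m$-ary (each operator having exactly one arity), and let $X=X_{\bar 0}\sqcup X_{\bar 1}$ be a well-ordered $\mathbb{Z}_2$-graded set. **$\Omega$-superalgebras.** A Lie superalgebra is a $\mathbb{Z}_2$-graded space $L=L_{\bar0}\oplus L_{\bar1}$ with a bilinear bracket such that $[L_{\bar i},L_{\bar j}]\subseteq L_{\bar i+\bar j}$, $[x,y]=-(-1)^{|x||y|}[y,x]$ and $[x,[y,z]]=[[x,y],z]+(-1)^{|x||y|}[y,[x,z]]$ for all homogeneous $x,y,z$. A Lie (or associative) $\Omega$-superalgebra is a Lie (or associative, not necessarily unital) superalgebra with, for each $\omega\in\Omega_m$, an $m$-linear operation $\omega$ such that $|\omega(a_1,\dots,a_m)|=|a_1|+\dots+|a_m|$ for homogeneous $a_i$. A homomorphism of Lie $\Omega$-superalgebras is an even linear map commuting with the bracket and with all operators. A Lie $\Omega$-superalgebra $L$ with a parity preserving map $X\to L$ is free on $X$ if every parity preserving map from $X$ to a Lie $\Omega$-superalgebra $M$ extends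 uniquely to a homomorphism $L\to M$. **$\Omega$-words.** Prime associative $\Omega$-words are the letters $x\in X$ and the expressions $\omega(u_1,\dots,u_m)$ with $\omega\in\Omega_m$ and $u_1,\dots,u_m$ associative $\Omega$-words; associative $\Omega$-words are the nonempty finite sequences $u=u_1\cdots u_n$ of prime ones, with $\mathrm{bre}(u)=n$. Nonassociative $\Omega$-words are obtained from $X$ by the operators of $\Omega$ and a binary product $((u)(v))$ with no identities. The degree $\deg(u)$ is the number of occurrences of letters and operators in $u$, and the parity $|u|\in\mathbb{Z}_2$ is the sum of the parities of all occurrences of letters. The order $>_{Dl}$ on associative $\Omega$-words compares $(\deg u,\mathrm{bre}\,u,u_1,\dots,u_n)$ lexicographically; here prime words are compared first by degree, prime words of equal degree that are letters by the order of $X$, and prime words of equal degree of the form $\omega(v_1,\dots,v_m)$ by comparing $(\omega,v_1,\dots,v_m)$ lexicographically. **The algebras.** $AS_k(\Omega;X)$ is the free associative $\Omega$-superalgebra on $X$: the $k$-space with basis the associative $\Omega$-words, graded by parity, with product extending concatenation bilinearly and operators extended multilinearly. It is a Lie $\Omega$-superalgebra under $[a,b]=ab-(-1)^{|a||b|}ba$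 ($a,b$ homogeneous), and $LS_k(\Omega;X)$ is its Lie $\Omega$-sub-superalgebra generated by $X$. **Super-Lyndon–Shirshov monomials.** Let $Y$ be a linearly ordered $\mathbb{Z}_2$-graded set of letters. On words in $Y$ let $>_{lex}$ be the lexicographic order in which the empty word is greater than every nonempty word. A nonempty word $u$ is an LS word if $u=vw>_{lex}wv$ for every decomposition $u=vw$ with $v,w$ nonempty. A nonassociative word $(u)$, with underlying word $u$, is an LS monomial if $u$ is an LS word and, when $(u)=((v)(w))$, both $(v)$ and $(w)$ are LS monomials, and moreover $v_2\le_{lex}w$ when $(v)=((v_1)(v_2))$. The set $SLSM(Y)$ of super-Lyndon–Shirshov (SLS) monomials on $Y$ consists of the LS monomials on $Y$ and of the squares $((v)(v))$ of LS monomials $(v)$ of odd parity. Put $SLSM(\Omega;X)^{(0)}=SLSM(X)$ and $$SLSM(\Omega;X)^{(n+1)}=SLSM\big(X\cup\{\omega(a_1,\dots,a_m): m\ge1,\ \omega\in\Omega_m,\ a_i\in SLSM(\Omega;X)^{(n)}\}\big),$$ where the letters are ordered by $>_{Dl}$ and graded by parity, both taken on their underlying associative $\Omega$-words. Let $SLSM(\Omega;X)=\bigcup_{n\ge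 0}SLSM(\Omega;X)^{(n)}$; its elements are nonassociative $\Omega$-words. **Theorem.** $LS_k(\Omega;X)$ is a free Lie $\Omega$-superalgebra on the $\mathbb{Z}_2$-graded set $X$, and $SLSM(\Omega;X)$, each monomial being evaluated in $LS_k(\Omega;X)$, is a linear basis of $LS_k(\Omega;X)$ (in particular, distinct monomials have distinct values). -/

import Mathlib

universe u v w z z'

/-! ### Super-Lyndon-Shirshov words and monomials on an ordered set of letters

`gt a b` stands for `a > b` and `par a` is the parity of the letter `a`.
Associative words are lists, nonassociative words are elements of the free magma. -/

namespace SuperLyndon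

variable {α : Type u}

/-- The lexicographic order `u >_lex v`, in which the empty word is the greatest word. -/
def LexGT (gt : α → α → Prop) : List α → List α → Prop
  | [], [] => False
  | [], _ :: _ => True
  | _ :: _, [] => False
  | a :: s, b :: t => gt a b ∨ (a = b ∧ LexGT gt s t)

/-- Lyndon-Shirshov words: nonempty words `u` such that `u = v w >_lex w v` for every
decomposition into two nonempty words. -/
def IsLSWord (gt : α → α → Prop) (s : List α) : Prop :=
  s ≠ [] ∧ ∀ v w : List α, v ≠ [] → w ≠ [] → s = v ++ w → LexGT gt s (w ++ v)

/-- The associative word obtained from a nonassociative word by forgetting the brackets. -/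
def word : FreeMagma α → List α
  | .of a => [a]
  | .mul s t => word s ++ word t

/-- Lyndon-Shirshov monomials. -/
def IsLSMonomial (gt : α → α → Prop) : FreeMagma α → Prop
  | .of a => IsLSWord gt [a]
  | .mul s t =>
      IsLSWord gt (word s ++ word t) ∧ IsLSMonomial gt s ∧ IsLSMonomial gt t ∧
        ∀ s₁ s₂ : FreeMagma α, s = s₁ * s₂ →
          (word s₂ = word t ∨ LexGT gt (word t) (word s₂))

/-- Super-Lyndon-Shirshov monomials: the LS monomials, and the squares `((v)(v))` of the
LS monomials `(v)` of odd parity. -/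
def IsSLSMonomial (gt : α → α → Prop) (par : α → ZMod 2) (t : FreeMagma α) : Prop :=
  IsLSMonomial gt t ∨
    ∃ s : FreeMagma α, t = s * s ∧ IsLSMonomial gt s ∧ ((word s).map par).sum = 1

end SuperLyndon

/-! ### Associative and nonassociative `Ω`-words

`Ω` is the set of all operators, and `ar ω` is the arity of the operator `ω`. -/

section Words

variable {Ω : Type v}

mutual

/-- Prime associative `Ω`-words: letters, and operators applied to associative `Ω`-words. -/
inductive OmegaPrime (ar : Ω → ℕ) (X : Type u) : Type (max u v)
  | var (x : X) : OmegaPrime ar X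
  | op (ω : Ω) (a : Fin (ar ω) → OmegaWord ar X) : OmegaPrime ar X

/-- Associative `Ω`-words: nonempty finite sequences of prime words. -/
inductive OmegaWord (ar : Ω → ℕ) (X : Type u) : Type (max u v)
  | single (p : OmegaPrime ar X) : OmegaWord ar X
  | cons (p : OmegaPrime ar X) (s : OmegaWord ar X) : OmegaWord ar X

end

/-- Nonassociative `Ω`-words. -/
inductive OmegaMonomial (ar : Ω → ℕ) (X : Type u) : Type (max u v)
  | var (x : X) : OmegaMonomial ar X
  | op (ω : Ω) (a : Fin (ar ω) → OmegaMonomial ar X) : OmegaMonomial ar X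
  | mul (s t : OmegaMonomial ar X) : OmegaMonomial ar X

variable {ar : Ω → ℕ} {X : Type u}

/-- Concatenation of associative `Ω`-words. -/
def OmegaWord.append : OmegaWord ar X → OmegaWord ar X → OmegaWord ar X
  | .single p, t => .cons p t
  | .cons p s, t => .cons p (s.append t)

instance : Mul (OmegaWord ar X) := ⟨OmegaWord.append⟩

instance : Mul (OmegaMonomial ar X) := ⟨OmegaMonomial.mul⟩

theorem OmegaWord.append_assoc (r s t : OmegaWord ar X) : r * s * t = r * (s * t) := by
  change (r.append s).append t = r.append (s.append t)
  match r with
  | .single p => rfl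
  | .cons p r =>
    simp only [OmegaWord.append]
    exact congrArg _ (OmegaWord.append_assoc r s t)

mutual

/-- The degree of a prime word: the number of occurrences of letters and operators. -/
def OmegaPrime.deg : OmegaPrime ar X → ℕ
  | .var _ => 1
  | .op _ a => 1 + ∑ i, (a i).deg

/-- The degree of a word: the number of occurrences of letters and operators. -/
def OmegaWord.deg : OmegaWord ar X → ℕ
  | .single p => p.deg
  | .cons p s => p.deg + s.deg

end

/-- The breadth of a word: the number of its prime factors. -/
def OmegaWord.bre : OmegaWord ar X → ℕ
  | .single _ => 1
  | .cons _ s => 1 + s.bre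

mutual

/-- The parity of a prime word: the sum of the parities of all occurrences of letters. -/
def OmegaPrime.parity (par : X → ZMod 2) : OmegaPrime ar X → ZMod 2
  | .var x => par x
  | .op _ a => ∑ i, (a i).parity par

/-- The parity of a word: the sum of the parities of all occurrences of letters. -/
def OmegaWord.parity (par : X → ZMod 2) : OmegaWord ar X → ZMod 2
  | .single p => p.parity par
  | .cons p s => p.parity par + s.parity par

end

theorem OmegaWord.parity_mul (par : X → ZMod 2) (s t : OmegaWord ar X) :
    (s * t).parity par = s.parity par + t.parity par := by
  change (s.append t).parity par = _
  match s with
  | .single p => simp only [OmegaWord.append, OmegaWord.parity]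
  | .cons p s =>
    simp only [OmegaWord.append, OmegaWord.parity]
    rw [add_assoc]
    exact congrArg _ (OmegaWord.parity_mul par s t)

mutual

/-- The order on prime words: first by degree, then letters by the order of `X`, and
`ω(u₁, …, uₘ)` by the lexicographic order of `(ω, u₁, …, uₘ)`. -/
inductive OmegaPrime.LT [LT X] [LT Ω] : OmegaPrime ar X → OmegaPrime ar X → Prop
  | deg {p q : OmegaPrime ar X} : p.deg < q.deg → OmegaPrime.LT p q
  | var {x y : X} : x < y → OmegaPrime.LT (.var x) (.var y)
  | op {ω θ : Ω} {a : Fin (ar ω) → OmegaWord ar X} {b : Fin (ar θ) → OmegaWord ar X} :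
      (OmegaPrime.op ω a).deg = (OmegaPrime.op θ b).deg → ω < θ →
      OmegaPrime.LT (.op ω a) (.op θ b)
  | args {ω : Ω} {a b : Fin (ar ω) → OmegaWord ar X} (i : Fin (ar ω)) :
      (OmegaPrime.op ω a).deg = (OmegaPrime.op ω b).deg → (∀ j < i, a j = b j) →
      OmegaWord.DegLexLT (a i) (b i) → OmegaPrime.LT (.op ω a) (.op ω b)

/-- The Deg-lex order `u <_Dl v`: the words `u = u₁ ⋯ uₙ` are compared by
`(deg u, bre u, u₁, …, uₙ)`, lexicographically. -/
inductive OmegaWord.DegLexLT [LT X] [LT Ω] : OmegaWord ar X → OmegaWord ar X → Prop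
  | deg {s t : OmegaWord ar X} : s.deg < t.deg → OmegaWord.DegLexLT s t
  | bre {s t : OmegaWord ar X} : s.deg = t.deg → s.bre < t.bre → OmegaWord.DegLexLT s t
  | lex {s t : OmegaWord ar X} : s.deg = t.deg → s.bre = t.bre → OmegaWord.LexLT s t →
      OmegaWord.DegLexLT s t

/-- Lexicographic comparison of the prime factors of two words of the same breadth. -/
inductive OmegaWord.LexLT [LT X] [LT Ω] : OmegaWord ar X → OmegaWord ar X → Prop
  | single {p q : OmegaPrime ar X} : OmegaPrime.LT p q →
      OmegaWord.LexLT (.single p) (.single q)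
  | head {p q : OmegaPrime ar X} {s t : OmegaWord ar X} : OmegaPrime.LT p q →
      OmegaWord.LexLT (.cons p s) (.cons q t)
  | tail {p : OmegaPrime ar X} {s t : OmegaWord ar X} : OmegaWord.LexLT s t →
      OmegaWord.LexLT (.cons p s) (.cons p t)

end

namespace OmegaMonomial

/-- The associative `Ω`-word obtained by forgetting all brackets. -/
def toWord : OmegaMonomial ar X → OmegaWord ar X
  | .var x => .single (.var x)
  | .op ω a => .single (.op ω fun i => (a i).toWord)
  | .mul s t => s.toWord * t.toWord

/-- The super-Lyndon-Shirshov monomials on a set `S` of nonassociative `Ω`-words taken as the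
letters. The order of the letters is the Deg-lex order of their underlying associative
`Ω`-words, and their parity is the parity of these words. -/
def slsOn [LT X] [LT Ω] (par : X → ZMod 2) (S : Set (OmegaMonomial ar X)) :
    Set (OmegaMonomial ar X) :=
  {m | ∃ t : FreeMagma S,
      SuperLyndon.IsSLSMonomial
        (fun a b : S => OmegaWord.DegLexLT b.1.toWord a.1.toWord)
        (fun a : S => a.1.toWord.parity par) t ∧
      m = FreeMagma.lift (fun a : S => a.1) t}

/-- `SLSM(Ω; X)⁽ⁿ⁾`, where `SLSM(Ω; X)⁽⁰⁾ = SLSM(X)` and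
`SLSM(Ω; X)⁽ⁿ⁺¹⁾ = SLSM(X ∪ Ω(SLSM(Ω; X)⁽ⁿ⁾))`. -/
def slsmLevel [LT X] [LT Ω] (ar : Ω → ℕ) (par : X → ZMod 2) :
    ℕ → Set (OmegaMonomial ar X)
  | 0 => slsOn par (Set.range OmegaMonomial.var)
  | n + 1 => slsOn par (Set.range OmegaMonomial.var ∪
      {m | ∃ (ω : Ω) (a : Fin (ar ω) → OmegaMonomial ar X),
        (∀ i, a i ∈ slsmLevel ar par n) ∧ m = .op ω a})

/-- The set `SLSM(Ω; X)` of all super-Lyndon-Shirshov `Ω`-monomials. -/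
def slsm [LT X] [LT Ω] (ar : Ω → ℕ) (par : X → ZMod 2) : Set (OmegaMonomial ar X) :=
  ⋃ n, slsmLevel ar par n

end OmegaMonomial

end Words

/-! ### Superspaces, associative and Lie `Ω`-superalgebras -/

/-- The sign `(-1)^{|x||y|}`. -/
def superSign (i j : ZMod 2) : ℤ := (-1) ^ (i.val * j.val)

theorem superSign_comm (i j : ZMod 2) : superSign i j = superSign j i := by
  rw [superSign, superSign, Nat.mul_comm]

theorem superSign_eq (i j : ZMod 2) : superSign i j = 1 ∨ superSign i j = -1 :=
  neg_one_pow_eq_or ℤ _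

theorem superSign_add (i j l : ZMod 2) :
    superSign i (j + l) = superSign i j * superSign i l := by
  revert i j l; decide

/-- A `ℤ₂`-grading `V = V₀ ⊕ V₁` of a linear space. -/
structure SuperGrading (k : Type w) (V : Type z) [Field k] [AddCommGroup V] [Module k V] where
  part : ZMod 2 → Submodule k V
  isCompl : IsCompl (part 0) (part 1)

namespace SuperGrading

variable {k : Type w} {V : Type z} [Field k] [AddCommGroup V] [Module k V]

/-- The projection of `V` onto its homogeneous component of parity `i`. -/
noncomputable def proj (G : SuperGrading k V) (i : ZMod 2) : V →ₗ[k] V :=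
  if i = 0 then (G.part 0).projection (G.part 1) G.isCompl
  else (G.part 1).projection (G.part 0) G.isCompl.symm

theorem proj_mem (G : SuperGrading k V) (i : ZMod 2) (x : V) : G.proj i x ∈ G.part i := by
  fin_cases i
  · exact Submodule.projection_apply_mem G.isCompl x
  · exact Submodule.projection_apply_mem G.isCompl.symm x

theorem proj_self (G : SuperGrading k V) {i : ZMod 2} {x : V} (hx : x ∈ G.part i) :
    G.proj i x = x := by
  fin_cases i
  · exact Submodule.projection_apply_left G.isCompl ⟨x, hx⟩
  · exact Submodule.projection_apply_left G.isCompl.symm ⟨x, hx⟩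

theorem proj_of_ne (G : SuperGrading k V) {i j : ZMod 2} {x : V} (hx : x ∈ G.part i)
    (hij : j ≠ i) : G.proj j x = 0 := by
  fin_cases i <;> fin_cases j
  · exact absurd rfl hij
  · exact (Submodule.projection_apply_eq_zero_iff G.isCompl.symm).2 hx
  · exact (Submodule.projection_apply_eq_zero_iff G.isCompl).2 hx
  · exact absurd rfl hij

theorem proj_add (G : SuperGrading k V) (x : V) : G.proj 0 x + G.proj 1 x = x :=
  Submodule.projection_add_projection_eq_self G.isCompl x

end SuperGrading

/-- A superspace with a set `Ω` of even multilinear operators, `ω` being `ar ω`-ary. -/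
structure OmegaSuperspace (k : Type w) {Ω : Type v} (ar : Ω → ℕ) (V : Type z)
    [Field k] [AddCommGroup V] [Module k V] extends SuperGrading k V where
  op : ∀ ω : Ω, MultilinearMap k (fun _ : Fin (ar ω) => V) V
  op_mem : ∀ (ω : Ω) (d : Fin (ar ω) → ZMod 2) (a : Fin (ar ω) → V),
    (∀ i, a i ∈ part (d i)) → op ω a ∈ part (∑ i, d i)

/-- An associative `Ω`-superalgebra structure (no unit is required) on a linear space. -/
structure AssocOmegaSuperalgebra (k : Type w) {Ω : Type v} (ar : Ω → ℕ) (A : Type z)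
    [Field k] [AddCommGroup A] [Module k A] extends OmegaSuperspace k ar A where
  mul : A →ₗ[k] A →ₗ[k] A
  mul_mem : ∀ (i j : ZMod 2) (x y : A), x ∈ part i → y ∈ part j → mul x y ∈ part (i + j)
  mul_assoc : ∀ x y t : A, mul x (mul y t) = mul (mul x y) t

/-- A Lie `Ω`-superalgebra structure on a linear space. -/
structure LieOmegaSuperalgebra (k : Type w) {Ω : Type v} (ar : Ω → ℕ) (L : Type z)
    [Field k] [AddCommGroup L] [Module k L] extends OmegaSuperspace k ar L where
  bracket : L →ₗ[k] L →ₗ[k] L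
  bracket_mem : ∀ (i j : ZMod 2) (x y : L), x ∈ part i → y ∈ part j →
    bracket x y ∈ part (i + j)
  skew : ∀ (i j : ZMod 2) (x y : L), x ∈ part i → y ∈ part j →
    bracket x y = -(superSign i j • bracket y x)
  jacobi : ∀ (i j l : ZMod 2) (x y t : L), x ∈ part i → y ∈ part j → t ∈ part l →
    bracket x (bracket y t) =
      bracket (bracket x y) t + superSign i j • bracket y (bracket x t)

namespace AssocOmegaSuperalgebra

variable {k : Type w} {Ω : Type v} {ar : Ω → ℕ} {A : Type z}
  [Field k] [AddCommGroup A] [Module k A]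

/-- The supercommutator: the bilinear map with `[a, b] = ab - (-1)^{|a||b|} ba` for
homogeneous `a` and `b`. -/
noncomputable def supercommutator (S : AssocOmegaSuperalgebra k ar A) : A →ₗ[k] A →ₗ[k] A :=
  S.mul - ∑ i : ZMod 2, ∑ j : ZMod 2,
    superSign i j • S.mul.flip.compl₁₂ (S.proj i) (S.proj j)

theorem supercommutator_apply (S : AssocOmegaSuperalgebra k ar A) {i j : ZMod 2} {a b : A}
    (ha : a ∈ S.part i) (hb : b ∈ S.part j) :
    S.supercommutator a b = S.mul a b - superSign i j • S.mul b a := by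
  simp only [supercommutator, LinearMap.sub_apply, LinearMap.sum_apply, LinearMap.smul_apply,
    LinearMap.compl₁₂_apply, LinearMap.flip_apply]
  rw [Finset.sum_eq_single i, Finset.sum_eq_single j, S.proj_self ha, S.proj_self hb]
  · intro j' _ hj
    simp [S.proj_of_ne hb hj]
  · simp
  · intro i' _ hi
    simp [S.proj_of_ne ha hi]
  · simp

/-- An associative `Ω`-superalgebra as a Lie `Ω`-superalgebra under the supercommutator. -/
noncomputable def toLie (S : AssocOmegaSuperalgebra k ar A) : LieOmegaSuperalgebra k ar A where
  toOmegaSuperspace := S.toOmegaSuperspace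
  bracket := S.supercommutator
  bracket_mem i j x y hx hy := by
    rw [S.supercommutator_apply hx hy]
    refine Submodule.sub_mem _ (S.mul_mem _ _ _ _ hx hy) (zsmul_mem ?_ _)
    rw [add_comm]
    exact S.mul_mem _ _ _ _ hy hx
  skew i j x y hx hy := by
    rw [S.supercommutator_apply hx hy, S.supercommutator_apply hy hx]
    rw [superSign_comm j i]
    rcases superSign_eq i j with h | h <;> simp [h]
  jacobi i j l x y t hx hy ht := by
    have hmem : ∀ {i j : ZMod 2} {x y : A}, x ∈ S.part i → y ∈ S.part j →
        S.supercommutator x y ∈ S.part (i + j) := by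
      intro i j x y hx hy
      rw [S.supercommutator_apply hx hy]
      refine Submodule.sub_mem _ (S.mul_mem _ _ _ _ hx hy) (zsmul_mem ?_ _)
      rw [add_comm]
      exact S.mul_mem _ _ _ _ hy hx
    rw [S.supercommutator_apply hx (hmem hy ht), S.supercommutator_apply (hmem hx hy) ht,
      S.supercommutator_apply hy (hmem hx ht), S.supercommutator_apply hx hy,
      S.supercommutator_apply hx ht, S.supercommutator_apply hy ht]
    rw [superSign_comm (i + j) l, superSign_add, superSign_add, superSign_add,
      superSign_comm l i, superSign_comm l j, superSign_comm j i]
    simp only [map_sub, map_zsmul, LinearMap.sub_apply, LinearMap.smul_apply, S.mul_assoc]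
    rcases superSign_eq i j with h1 | h1 <;> rcases superSign_eq i l with h2 | h2 <;>
      rcases superSign_eq j l with h3 | h3 <;> rw [h1, h2, h3] <;> module

end AssocOmegaSuperalgebra

namespace LieOmegaSuperalgebra

variable {k : Type w} {Ω : Type v} {ar : Ω → ℕ} {L : Type z}
  [Field k] [AddCommGroup L] [Module k L]

/-- Lie `Ω`-sub-superalgebras: graded subspaces closed under the bracket and all operators. -/
structure IsSub (S : LieOmegaSuperalgebra k ar L) (N : Submodule k L) : Prop where
  proj_mem : ∀ (i : ZMod 2) (x : L), x ∈ N → S.proj i x ∈ N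
  bracket_mem : ∀ x y : L, x ∈ N → y ∈ N → S.bracket x y ∈ N
  op_mem : ∀ (ω : Ω) (a : Fin (ar ω) → L), (∀ i, a i ∈ N) → S.op ω a ∈ N

/-- The Lie `Ω`-sub-superalgebra generated by a set. -/
def gen (S : LieOmegaSuperalgebra k ar L) (s : Set L) : Submodule k L :=
  sInf {N | s ⊆ N ∧ S.IsSub N}

theorem subset_gen (S : LieOmegaSuperalgebra k ar L) (s : Set L) : s ⊆ S.gen s := by
  intro x hx
  simp only [gen, SetLike.mem_coe, Submodule.mem_sInf]
  exact fun N hN => hN.1 hx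

theorem isSub_gen (S : LieOmegaSuperalgebra k ar L) (s : Set L) : S.IsSub (S.gen s) where
  proj_mem i x hx := by
    simp only [gen, Submodule.mem_sInf] at hx ⊢
    exact fun N hN => hN.2.proj_mem i x (hx N hN)
  bracket_mem x y hx hy := by
    simp only [gen, Submodule.mem_sInf] at hx hy ⊢
    exact fun N hN => hN.2.bracket_mem x y (hx N hN) (hy N hN)
  op_mem ω a ha := by
    simp only [gen, Submodule.mem_sInf] at ha ⊢
    exact fun N hN => hN.2.op_mem ω a fun i => ha i N hN

/-- A Lie `Ω`-sub-superalgebra with the operations and the grading of the ambient one. -/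
noncomputable def restrict (S : LieOmegaSuperalgebra k ar L) {N : Submodule k L}
    (h : S.IsSub N) : LieOmegaSuperalgebra k ar N where
  part i := (S.part i).comap N.subtype
  isCompl := by
    constructor
    · rw [Submodule.disjoint_def]
      intro x h0 h1
      exact Subtype.ext (Submodule.disjoint_def.1 S.isCompl.disjoint x.1 h0 h1)
    · rw [codisjoint_iff, eq_top_iff]
      intro x _
      have hx : x = ⟨S.proj 0 x, h.proj_mem 0 x x.2⟩ + ⟨S.proj 1 x, h.proj_mem 1 x x.2⟩ :=
        Subtype.ext (S.proj_add x.1).symm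
      rw [hx]
      exact Submodule.add_mem_sup (S.proj_mem 0 x.1) (S.proj_mem 1 x.1)
  op ω := ((S.op ω).compLinearMap fun _ => N.subtype).codRestrict N fun a =>
    h.op_mem ω _ fun i => (a i).2
  op_mem ω d a ha := S.op_mem ω d (fun i => (a i).1) ha
  bracket := LinearMap.mk₂ k (fun x y => ⟨S.bracket x y, h.bracket_mem x y x.2 y.2⟩)
    (fun _ _ _ => Subtype.ext (by simp)) (fun _ _ _ => Subtype.ext (by simp))
    (fun _ _ _ => Subtype.ext (by simp)) (fun _ _ _ => Subtype.ext (by simp))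
  bracket_mem i j x y hx hy := S.bracket_mem i j x.1 y.1 hx hy
  skew i j x y hx hy := Subtype.ext (by simpa using S.skew i j x.1 y.1 hx hy)
  jacobi i j l x y t hx hy ht :=
    Subtype.ext (by simpa using S.jacobi i j l x.1 y.1 t.1 hx hy ht)

/-- Homomorphisms of Lie `Ω`-superalgebras: even linear maps that commute with the bracket
and with all operators. -/
structure IsHom {M : Type z'} [AddCommGroup M] [Module k M] (S : LieOmegaSuperalgebra k ar L)
    (T : LieOmegaSuperalgebra k ar M) (φ : L →ₗ[k] M) : Prop where
  even : ∀ (i : ZMod 2) (x : L), x ∈ S.part i → φ x ∈ T.part i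
  map_bracket : ∀ x y : L, φ (S.bracket x y) = T.bracket (φ x) (φ y)
  map_op : ∀ (ω : Ω) (a : Fin (ar ω) → L), φ (S.op ω a) = T.op ω fun i => φ (a i)

/-- `L` is a free Lie `Ω`-superalgebra on the `ℤ₂`-graded set `X` (with parity `par`), mapped
to `L` by `ι`: every parity preserving map from `X` to a Lie `Ω`-superalgebra extends
uniquely to a homomorphism. -/
def IsFreeOn {X : Type u} (S : LieOmegaSuperalgebra k ar L) (par : X → ZMod 2)
    (ι : X → L) : Prop :=
  (∀ x, ι x ∈ S.part (par x)) ∧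
  ∀ (M : Type z') [AddCommGroup M] [Module k M] (T : LieOmegaSuperalgebra k ar M) (f : X → M),
    (∀ x, f x ∈ T.part (par x)) →
      ∃! φ : L →ₗ[k] M, S.IsHom T φ ∧ ∀ x, φ (ι x) = f x

/-- The value of a nonassociative `Ω`-word in a Lie `Ω`-superalgebra. -/
def eval {X : Type u} (S : LieOmegaSuperalgebra k ar L) (f : X → L) :
    OmegaMonomial ar X → L
  | .var x => f x
  | .op ω a => S.op ω fun i => S.eval f (a i)
  | .mul s t => S.bracket (S.eval f s) (S.eval f t)

end LieOmegaSuperalgebra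

/-! ### The free associative `Ω`-superalgebra and the Lie `Ω`-superalgebra generated by `X` -/

section Free

variable (k : Type w) [Field k] {Ω : Type v} (ar : Ω → ℕ) {X : Type u}

/-- The bilinear extension of the concatenation of `Ω`-words. -/
noncomputable def omegaWordMul :
    (OmegaWord ar X →₀ k) →ₗ[k] (OmegaWord ar X →₀ k) →ₗ[k] (OmegaWord ar X →₀ k) :=
  Finsupp.linearCombination k fun s => Finsupp.lmapDomain k k fun t => s * t

/-- The multilinear extension of the operator `(w₁, …, wₘ) ↦ ω(w₁, …, wₘ)` on `Ω`-words. -/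
noncomputable def omegaWordOp (ω : Ω) :
    MultilinearMap k (fun _ : Fin (ar ω) => OmegaWord ar X →₀ k) (OmegaWord ar X →₀ k) :=
  ((Basis.piTensorProduct fun _ : Fin (ar ω) =>
      (Finsupp.basisSingleOne : Module.Basis (OmegaWord ar X) k (OmegaWord ar X →₀ k))).constr k
    fun s => Finsupp.single (OmegaWord.single (OmegaPrime.op ω s)) 1).compMultilinearMap
    (PiTensorProduct.tprod k)

variable {k ar}

theorem omegaWordMul_single (s t : OmegaWord ar X) (a b : k) :
    omegaWordMul k ar (Finsupp.single s a) (Finsupp.single t b) =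
      Finsupp.single (s * t) (a * b) := by
  rw [omegaWordMul, Finsupp.linearCombination_single, LinearMap.smul_apply,
    Finsupp.lmapDomain_apply, Finsupp.mapDomain_single, Finsupp.smul_single, smul_eq_mul]

theorem omegaWordOp_single (ω : Ω) (s : Fin (ar ω) → OmegaWord ar X) :
    omegaWordOp k ar ω (fun i => Finsupp.single (s i) 1) =
      Finsupp.single (OmegaWord.single (OmegaPrime.op ω s)) 1 := by
  have h := Basis.piTensorProduct_apply (R := k) (fun _ : Fin (ar ω) =>
      (Finsupp.basisSingleOne : Module.Basis (OmegaWord ar X) k (OmegaWord ar X →₀ k))) s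
  simp only [Finsupp.coe_basisSingleOne] at h
  simp only [omegaWordOp, LinearMap.compMultilinearMap_apply]
  rw [← h, Module.Basis.constr_basis]

/-- The span of the `Ω`-words of parity `i`. -/
noncomputable def omegaWordPart (k : Type w) [Field k] (ar : Ω → ℕ) (par : X → ZMod 2) (i : ZMod 2) :
    Submodule k (OmegaWord ar X →₀ k) :=
  Submodule.span k ((fun s => Finsupp.single s 1) '' {s : OmegaWord ar X | s.parity par = i})

theorem omegaWordPart_isCompl (par : X → ZMod 2) :
    IsCompl (omegaWordPart k ar par 0) (omegaWordPart k ar par 1) := by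
  simp only [omegaWordPart, ← Finsupp.supported_eq_span_single]
  constructor
  · rw [Finsupp.disjoint_supported_supported_iff, Set.disjoint_left]
    intro s h0 h1
    exact absurd (h0.symm.trans h1) (by decide)
  · refine Finsupp.codisjoint_supported_supported ?_
    rw [codisjoint_iff, eq_top_iff]
    intro s _
    have : ∀ i : ZMod 2, i = 0 ∨ i = 1 := by decide
    exact this (s.parity par)

theorem omegaWordMul_mem (par : X → ZMod 2) (i j : ZMod 2) (x y : OmegaWord ar X →₀ k)
    (hx : x ∈ omegaWordPart k ar par i) (hy : y ∈ omegaWordPart k ar par j) :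
    omegaWordMul k ar x y ∈ omegaWordPart k ar par (i + j) := by
  refine Submodule.span_induction₂ (p := fun x y _ _ =>
    omegaWordMul k ar x y ∈ omegaWordPart k ar par (i + j)) ?_ ?_ ?_ ?_ ?_ ?_ ?_ hx hy
  · rintro _ _ ⟨s, hs, rfl⟩ ⟨t, ht, rfl⟩
    simp only [omegaWordMul_single, mul_one]
    refine Submodule.subset_span ⟨s * t, ?_, rfl⟩
    rw [Set.mem_ofPred_eq] at hs ht ⊢
    rw [OmegaWord.parity_mul, hs, ht]
  · intro y _; simp
  · intro x _; simp
  · intro x y z _ _ _ h1 h2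
    rw [map_add, LinearMap.add_apply]; exact add_mem h1 h2
  · intro x y z _ _ _ h1 h2
    rw [map_add]; exact add_mem h1 h2
  · intro r x y _ _ h
    rw [map_smul, LinearMap.smul_apply]; exact Submodule.smul_mem _ _ h
  · intro r x y _ _ h
    rw [map_smul]; exact Submodule.smul_mem _ _ h

theorem omegaWordMul_assoc (x y z : OmegaWord ar X →₀ k) :
    omegaWordMul k ar x (omegaWordMul k ar y z) =
      omegaWordMul k ar (omegaWordMul k ar x y) z := by
  induction x using Finsupp.induction_linear with
  | zero => simp
  | add f g hf hg => simp [hf, hg]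
  | single s a =>
    induction y using Finsupp.induction_linear with
    | zero => simp
    | add f g hf hg => simp [hf, hg]
    | single t b =>
      induction z using Finsupp.induction_linear with
      | zero => simp
      | add f g hf hg => simp [hf, hg]
      | single r c =>
        rw [omegaWordMul_single, omegaWordMul_single, omegaWordMul_single, omegaWordMul_single,
          OmegaWord.append_assoc, mul_assoc]

theorem omegaWordOp_mem (par : X → ZMod 2) (ω : Ω) (d : Fin (ar ω) → ZMod 2)
    (a : Fin (ar ω) → OmegaWord ar X →₀ k) (ha : ∀ i, a i ∈ omegaWordPart k ar par (d i)) :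
    omegaWordOp k ar ω a ∈ omegaWordPart k ar par (∑ i, d i) := by
  classical
  have ha' : ∀ i, a i = ∑ s ∈ (a i).support, a i s • Finsupp.single s (1 : k) := by
    intro i
    conv_lhs => rw [← Finsupp.sum_single (a i)]
    simp [Finsupp.sum]
  rw [funext ha', MultilinearMap.map_sum_finset]
  refine Submodule.sum_mem _ fun r hr => ?_
  rw [MultilinearMap.map_smul_univ]
  refine Submodule.smul_mem _ _ ?_
  rw [omegaWordOp_single]
  refine Submodule.subset_span ⟨_, ?_, rfl⟩
  rw [Set.mem_ofPred_eq]
  simp only [OmegaWord.parity, OmegaPrime.parity]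
  refine Finset.sum_congr rfl fun i _ => ?_
  have h := ha i
  rw [omegaWordPart, ← Finsupp.supported_eq_span_single, Finsupp.mem_supported] at h
  exact h (Fintype.mem_piFinset.1 hr i)

/-- The free associative `Ω`-superalgebra `AS_k(Ω; X)`: the space spanned by the associative
`Ω`-words. -/
noncomputable def freeAssocOmega (k : Type w) [Field k] (ar : Ω → ℕ) (par : X → ZMod 2) :
    AssocOmegaSuperalgebra k ar (OmegaWord ar X →₀ k) where
  part := omegaWordPart k ar par
  isCompl := omegaWordPart_isCompl par
  op := omegaWordOp k ar
  op_mem := omegaWordOp_mem par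
  mul := omegaWordMul k ar
  mul_mem := omegaWordMul_mem par
  mul_assoc := omegaWordMul_assoc

/-- The letter `x` as an element of `AS_k(Ω; X)`. -/
noncomputable def omegaLetter (k : Type w) [Field k] (ar : Ω → ℕ) (x : X) :
    OmegaWord ar X →₀ k :=
  Finsupp.single (OmegaWord.single (OmegaPrime.var x)) 1

/-- `LS_k(Ω; X)`: the Lie `Ω`-sub-superalgebra of `AS_k(Ω; X)` generated by `X`, as a
subspace. -/
noncomputable def LSOmega (k : Type w) [Field k] (ar : Ω → ℕ) (par : X → ZMod 2) :
    Submodule k (OmegaWord ar X →₀ k) :=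
  (freeAssocOmega k ar par).toLie.gen (Set.range (omegaLetter k ar))

/-- The Lie `Ω`-superalgebra structure of `LS_k(Ω; X)`. -/
noncomputable def LSOmega.lie (k : Type w) [Field k] (ar : Ω → ℕ) (par : X → ZMod 2) :
    LieOmegaSuperalgebra k ar (LSOmega k ar par) :=
  (freeAssocOmega k ar par).toLie.restrict
    ((freeAssocOmega k ar par).toLie.isSub_gen (Set.range (omegaLetter k ar)))

/-- The letter `x` as an element of `LS_k(Ω; X)`. -/
noncomputable def LSOmega.letter (k : Type w) [Field k] (ar : Ω → ℕ) (par : X → ZMod 2)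
    (x : X) : LSOmega k ar par :=
  ⟨omegaLetter k ar x, (freeAssocOmega k ar par).toLie.subset_gen _ (Set.mem_range_self x)⟩

end Free

/-!
Both halves of the theorem rest on one description of the set of monomials. By
`OmegaMonomial.slsm_eq` the super-Lyndon-Shirshov (SLS) `Ω`-monomials are the SLS monomials on a
single alphabet: the variables together with the operators applied to SLS `Ω`-monomials. An
operator is therefore applied freely, and all that has to be understood is the bracket, for which
the letters of this alphabet may be treated as generators of a plain Lie superalgebra.

*Spanning, in every Lie `Ω`-superalgebra.* Order the letters by `a < b` if `a >_Dl b`. Then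
`>_lex` is the usual lexicographic order on lists, and the Lyndon-Shirshov words are the Lyndon
words, smaller than all their proper suffixes (`SuperLyndon.isLSWord_iff`). For Lyndon monomials
`s < t` either `s t` is again a Lyndon monomial, or `s = s₁ s₂` with `s₂ < t`, and then the Jacobi
identity expresses `[s, t]` through `[s₁, [s₂, t]]` and `[s₂, [s₁, t]]`. The inner brackets are
shorter, and expand into monomials with words smaller than `t`. The outer brackets have the
original length but involve only words smaller than `t`; as there are finitely many words of
bounded length in finitely many letters, this recursion ends
(`LieOmegaSuperalgebra.bracketBounded`). The squares of odd monomials are carried along: they arise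
as `[z, z]`, and brackets with them reduce to `[z, [s, z]]`. Characteristic zero gives `[x, x] = 0`
for even `x` and `[x, [x, x]] = 0` for odd `x`. So the values of the SLS `Ω`-monomials span a Lie
`Ω`-sub-superalgebra (`LieOmegaSuperalgebra.isSub_span_eval_slsm`).

*Independence, in the free associative `Ω`-superalgebra.* The value of an SLS `Ω`-monomial has its
underlying word as Deg-lex leading word, with a nonzero coefficient
(`OmegaMonomial.isLeading_eval_slsm`): for Lyndon monomials this is the inequality `v w >_lex w v`,
and for the square of an odd monomial the two terms of the supercommutator add up. A Lyndon word
carries only one Lyndon bracketing, because the right factor is its smallest proper suffix; hence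
different SLS `Ω`-monomials have different words (`OmegaMonomial.injOn_toWord_slsm`).

*Freeness.* Given a map from `X` to a Lie `Ω`-superalgebra `M`, the spanning result for the product
`LS_k(Ω; X) × M` shows that the span of the values of the SLS `Ω`-monomials in this product is a
sub-superalgebra. By independence in the first component it is the graph of a linear map, which is
then the homomorphism sought (`LieOmegaSuperalgebra.isFreeOn_of_basis`).
-/

/-! ### Lyndon words -/

namespace SuperLyndon

section LinearOrder

variable {α : Type u} [LinearOrder α]

theorem lexGT_lt_iff (s t : List α) : LexGT (fun a b : α => a < b) s t ↔ s < t := by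
  induction s generalizing t with
  | nil => cases t <;> simp [LexGT]
  | cons a s ih =>
    cases t with
    | nil => simp [LexGT]
    | cons b t => rw [LexGT, ih, List.cons_lt_cons_iff]

theorem append_lt_append_left_iff (s t r : List α) : s ++ t < s ++ r ↔ t < r := by
  induction s with
  | nil => simp
  | cons a s ih => simp [ih]

theorem lt_append_right (s : List α) {t : List α} (ht : t ≠ []) : s < s ++ t := by
  obtain ⟨a, t, rfl⟩ := List.exists_cons_of_ne_nil ht
  simpa using (append_lt_append_left_iff s [] (a :: t)).2 (List.nil_lt_cons a t)

/-- A comparison that is decided by a letter survives any continuation of the two words. -/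
theorem append_lt_append_of_not_prefix {s t : List α} (h : s < t) (hp : ¬ s <+: t)
    (x y : List α) : s ++ x < t ++ y := by
  induction s generalizing t with
  | nil => exact absurd t.nil_prefix hp
  | cons a s ih =>
    cases t with
    | nil => simp at h
    | cons b t =>
      rw [List.cons_lt_cons_iff] at h
      rw [List.cons_append, List.cons_append, List.cons_lt_cons_iff]
      rcases h with h | ⟨rfl, h⟩
      · exact Or.inl h
      · exact Or.inr ⟨rfl, ih h fun hs => hp (by simpa using hs)⟩

theorem append_lt_append_of_length_le {s t : List α} (h : s < t) (hl : t.length ≤ s.length)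
    (x y : List α) : s ++ x < t ++ y := by
  refine append_lt_append_of_not_prefix h (fun hp => ?_) x y
  rw [hp.eq_of_length_le hl] at h
  exact lt_irrefl _ h

/-- The words of `IsLSWord` are the Lyndon words: those smaller, in the usual lexicographic
order, than all their proper suffixes. -/
theorem isLSWord_iff (s : List α) : IsLSWord (fun a b : α => a < b) s ↔
    s ≠ [] ∧ ∀ v w : List α, v ≠ [] → w ≠ [] → s = v ++ w → s < w := by
  refine and_congr_right fun _ => ⟨fun h v w hv hw hs => ?_, fun h v w hv hw hs => ?_⟩
  · subst hs
    have h1 := (lexGT_lt_iff _ _).1 (h v w hv hw rfl)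
    by_contra h2
    rcases (not_lt.1 h2).lt_or_eq with h3 | h3
    · by_cases hp : w <+: v ++ w
      · -- here `v w = w v'`, and the Lyndon conditions for the two decompositions contradict
        -- each other: they say `v' < v` and `w v' < v' w`
        obtain ⟨v', hv'⟩ := hp
        have hl : v'.length = v.length := by
          have := congrArg List.length hv'
          simp only [List.length_append] at this
          omega
        have h4 : v' < v := by
          rwa [← hv', append_lt_append_left_iff] at h1
        have h5 := (lexGT_lt_iff _ _).1
          (h w v' hw (fun h => hv (by simpa [h] using hl.symm)) hv'.symm)
        exact lt_asymm h5 (append_lt_append_of_length_le h4 hl.symm.le w w)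
      · have := append_lt_append_of_not_prefix h3 hp v []
        rw [List.append_nil] at this
        exact lt_asymm h1 this
    · have := congrArg List.length h3
      simp only [List.length_append] at this
      exact hv (List.length_eq_zero_iff.1 (by omega))
  · rw [lexGT_lt_iff]
    have h1 := h v w hv hw hs
    have := append_lt_append_of_length_le h1 (by simp [hs]) [] v
    simpa using this

theorem IsLSWord.lt_suffix {v w : List α} (h : IsLSWord (fun a b : α => a < b) (v ++ w))
    (hv : v ≠ []) (hw : w ≠ []) : v ++ w < w :=
  ((isLSWord_iff _).1 h).2 v w hv hw rfl

theorem IsLSWord.append_lt {s t : List α} (ht : IsLSWord (fun a b : α => a < b) t)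
    (hs : s ≠ []) (h : s < t) : s ++ t < t := by
  by_cases hp : s <+: t
  · obtain ⟨r, rfl⟩ := hp
    have hr : r ≠ [] := by
      rintro rfl
      simp at h
    rw [append_lt_append_left_iff]
    exact ht.lt_suffix hs hr
  · simpa using append_lt_append_of_not_prefix h hp t []

theorem IsLSWord.append {s t : List α} (hs : IsLSWord (fun a b : α => a < b) s)
    (ht : IsLSWord (fun a b : α => a < b) t) (h : s < t) :
    IsLSWord (fun a b : α => a < b) (s ++ t) := by
  have hst := ht.append_lt hs.1 h
  refine (isLSWord_iff _).2 ⟨by simp [hs.1], fun v w hv hw he => ?_⟩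
  rcases List.append_eq_append_iff.1 he with ⟨r, rfl, rfl⟩ | ⟨r, rfl, rfl⟩
  · by_cases hr : r = []
    · subst hr; simpa using hst
    · exact hst.trans (ht.lt_suffix hr hw)
  · by_cases hr : r = []
    · subst hr; simpa using hst
    · rw [List.append_assoc] at hst ⊢
      have h1 := hs.lt_suffix hv hr
      simpa using append_lt_append_of_length_le h1 (by simp) t t

theorem word_ne_nil {β : Type*} (t : FreeMagma β) : word t ≠ [] := by
  induction t with
  | ih1 a => simp [word]
  | ih2 s t hs _ => exact fun h => hs (List.append_eq_nil_iff.1 h).1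

theorem word_mul {β : Type*} (s t : FreeMagma β) : word (s * t) = word s ++ word t := rfl

theorem isLSMonomial_mul_iff {s t : FreeMagma α} :
    IsLSMonomial (fun a b : α => a < b) (s * t) ↔
      IsLSWord (fun a b : α => a < b) (word s ++ word t) ∧
      IsLSMonomial (fun a b : α => a < b) s ∧ IsLSMonomial (fun a b : α => a < b) t ∧
        ∀ s₁ s₂ : FreeMagma α, s = s₁ * s₂ → word t ≤ word s₂ := by
  change IsLSMonomial _ (FreeMagma.mul s t) ↔ _
  simp only [IsLSMonomial, lexGT_lt_iff, le_iff_lt_or_eq, eq_comm, or_comm]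

theorem isLSMonomial_of (a : α) : IsLSMonomial (fun a b : α => a < b) (.of a) := by
  refine (isLSWord_iff _).2 ⟨by simp, fun v w hv hw h => ?_⟩
  rcases List.singleton_eq_append_iff.1 h with h | h
  · exact absurd h.1 hv
  · exact absurd h.2 hw

theorem IsLSMonomial.isLSWord {t : FreeMagma α} (h : IsLSMonomial (fun a b : α => a < b) t) :
    IsLSWord (fun a b : α => a < b) (word t) := by
  cases t with
  | of a => exact h
  | mul s t => exact (isLSMonomial_mul_iff.1 h).1

/-- The right factor of an LS monomial is the smallest proper suffix of its word. This
determines the bracketing of a Lyndon word. -/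
theorem IsLSMonomial.right_le_suffix {s t : FreeMagma α}
    (h : IsLSMonomial (fun a b : α => a < b) (s * t)) {v w : List α} (hv : v ≠ [])
    (hw : w ≠ []) (he : word s ++ word t = v ++ w) : word t ≤ w := by
  induction s generalizing t v w with
  | ih1 a =>
    obtain ⟨b, v, rfl⟩ := List.exists_cons_of_ne_nil hv
    simp only [word, List.cons_append, List.nil_append, List.cons.injEq] at he
    rw [he.2]
    by_cases hv' : v = []
    · subst hv'; simp
    · have ht := (isLSMonomial_mul_iff.1 h).2.2.1.isLSWord
      rw [he.2] at ht
      exact (ht.lt_suffix hv' hw).le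
  | ih2 s₁ s₂ ih _ =>
    obtain ⟨h0, hs, ht, h2⟩ := isLSMonomial_mul_iff.1 h
    have h2 : word t ≤ word s₂ := h2 s₁ s₂ rfl
    rcases List.append_eq_append_iff.1 he with ⟨r, rfl, h3⟩ | ⟨r, h3, rfl⟩
    · by_cases hr : r = []
      · subst hr; simp [h3]
      · have ht := ht.isLSWord
        rw [h3] at ht ⊢
        exact (ht.lt_suffix hr hw).le
    · by_cases hr : r = []
      · subst hr; simp
      · have h4 : word s₂ ≤ r := ih hs hv hr h3
        exact (h2.trans h4).trans (lt_append_right r (word_ne_nil t)).le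

/-- A word is the underlying word of at most one LS monomial. -/
theorem IsLSMonomial.eq_of_word_eq {s t : FreeMagma α}
    (hs : IsLSMonomial (fun a b : α => a < b) s) (ht : IsLSMonomial (fun a b : α => a < b) t)
    (h : word s = word t) : s = t := by
  induction s generalizing t with
  | ih1 a =>
    cases t with
    | of b => exact congrArg FreeMagma.of (by simpa [word] using h)
    | mul t₁ t₂ =>
      have := congrArg List.length h
      have h1 := List.length_pos_iff.2 (word_ne_nil t₁)
      have h2 := List.length_pos_iff.2 (word_ne_nil t₂)
      simp only [word, List.length_append, List.length_singleton] at this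
      omega
  | ih2 s₁ s₂ ih₁ ih₂ =>
    cases t with
    | of b =>
      have := congrArg List.length h
      have h1 := List.length_pos_iff.2 (word_ne_nil s₁)
      have h2 := List.length_pos_iff.2 (word_ne_nil s₂)
      simp only [word, List.length_append, List.length_singleton] at this
      omega
    | mul t₁ t₂ =>
      have h : word s₁ ++ word s₂ = word t₁ ++ word t₂ := h
      change IsLSMonomial _ (t₁ * t₂) at ht
      have h2 : word s₂ = word t₂ := le_antisymm
        (hs.right_le_suffix (word_ne_nil _) (word_ne_nil _) h)
        (ht.right_le_suffix (word_ne_nil _) (word_ne_nil _) h.symm)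
      rw [h2, List.append_left_inj] at h
      have hs' := isLSMonomial_mul_iff.1 hs
      have ht' := isLSMonomial_mul_iff.1 ht
      exact congrArg₂ FreeMagma.mul (ih₁ hs'.2.1 ht'.2.1 h) (ih₂ hs'.2.2.1 ht'.2.2.1 h2)

theorem not_isLSWord_append_self (v : List α) :
    ¬ IsLSWord (fun a b : α => a < b) (v ++ v) := by
  intro h
  by_cases hv : v = []
  · exact h.1 (by simp [hv])
  · exact lt_irrefl _ ((lexGT_lt_iff _ _).1 (h.2 v v hv hv rfl))

theorem IsSLSMonomial.eq_of_word_eq {par : α → ZMod 2} {s t : FreeMagma α}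
    (hs : IsSLSMonomial (fun a b : α => a < b) par s)
    (ht : IsSLSMonomial (fun a b : α => a < b) par t) (h : word s = word t) : s = t := by
  rcases hs with hs | ⟨s, rfl, hs, -⟩ <;> rcases ht with ht | ⟨t, rfl, ht, -⟩
  · exact hs.eq_of_word_eq ht h
  · exact absurd (word_mul t t ▸ h ▸ hs.isLSWord) (not_isLSWord_append_self (word t))
  · exact absurd (word_mul s s ▸ h ▸ ht.isLSWord) (not_isLSWord_append_self (word s))
  · rw [word_mul, word_mul] at h
    have hl := congrArg List.length h
    simp only [List.length_append] at hl
    rw [hs.eq_of_word_eq ht (List.append_inj_left h (by omega))]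

end LinearOrder
end SuperLyndon

/-! ### Super-Lyndon-Shirshov monomials span a Lie superalgebra -/

namespace LieOmegaSuperalgebra

open SuperLyndon

variable {k : Type w} {Ω : Type v} {ar : Ω → ℕ} {L : Type z}
  [Field k] [AddCommGroup L] [Module k L]

section Homogeneous

variable (T : LieOmegaSuperalgebra k ar L) {i j l : ZMod 2} {x y t : L} {V : Submodule k L}

theorem bracket_swap_mem (hx : x ∈ T.part i) (hy : y ∈ T.part j) (h : T.bracket x y ∈ V) :
    T.bracket y x ∈ V := by
  rw [T.skew j i y x hy hx]
  exact V.neg_mem (zsmul_mem h _)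

theorem bracket_bracket_mem (hx : x ∈ T.part i) (hy : y ∈ T.part j) (ht : t ∈ T.part l)
    (h₁ : T.bracket x (T.bracket y t) ∈ V) (h₂ : T.bracket y (T.bracket x t) ∈ V) :
    T.bracket (T.bracket x y) t ∈ V := by
  rw [eq_sub_of_add_eq (T.jacobi i j l x y t hx hy ht).symm]
  exact V.sub_mem h₁ (zsmul_mem h₂ _)

theorem bracket_self_of_even [CharZero k] (hx : x ∈ T.part 0) : T.bracket x x = 0 := by
  have h := T.skew 0 0 x x hx hx
  rw [show superSign 0 0 = 1 from rfl, one_smul] at h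
  have h2 : (2 : k) • T.bracket x x = 0 := by
    rw [two_smul]
    nth_rewrite 1 [h]
    exact neg_add_cancel _
  exact (smul_eq_zero.1 h2).resolve_left two_ne_zero

theorem bracket_bracket_self_of_odd [CharZero k] (hx : x ∈ T.part 1) :
    T.bracket x (T.bracket x x) = 0 := by
  have h := T.jacobi 1 1 1 x x x hx hx hx
  have h' := T.skew (1 + 1) 1 (T.bracket x x) x (T.bracket_mem 1 1 x x hx hx) hx
  rw [show superSign (1 + 1) 1 = 1 from rfl, one_smul] at h'
  rw [show superSign 1 1 = -1 from rfl, h', neg_one_smul] at h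
  have h3 : (3 : k) • T.bracket x (T.bracket x x) = 0 := by
    rw [show (3 : k) = 1 + 1 + 1 by norm_num, add_smul, add_smul, one_smul]
    nth_rewrite 1 [h]
    abel
  exact (smul_eq_zero.1 h3).resolve_left three_ne_zero

/-- The Jacobi identity reduces the bracket with a square `[y, y]` to iterated brackets
with `y`. -/
theorem bracket_square_mem (hx : x ∈ T.part i) (hy : y ∈ T.part j)
    (h : T.bracket y (T.bracket x y) ∈ V) : T.bracket x (T.bracket y y) ∈ V := by
  rw [T.jacobi i j j x y y hx hy hy]
  exact V.add_mem (T.bracket_swap_mem hy (T.bracket_mem i j x y hx hy) h) (zsmul_mem h _)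

end Homogeneous

variable {α : Type u}

/-- The value of a nonassociative word in the letters `α` in a Lie superalgebra. -/
def treeEval (T : LieOmegaSuperalgebra k ar L) (g : α → L) : FreeMagma α → L
  | .of a => g a
  | .mul s t => T.bracket (T.treeEval g s) (T.treeEval g t)

theorem treeEval_mul (T : LieOmegaSuperalgebra k ar L) (g : α → L) (s t : FreeMagma α) :
    T.treeEval g (s * t) = T.bracket (T.treeEval g s) (T.treeEval g t) := rfl

theorem treeEval_mem (T : LieOmegaSuperalgebra k ar L) {g : α → L} {par : α → ZMod 2}
    (hg : ∀ a, g a ∈ T.part (par a)) (t : FreeMagma α) :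
    T.treeEval g t ∈ T.part ((word t).map par).sum := by
  induction t with
  | ih1 a => simpa [word, treeEval] using hg a
  | ih2 s t hs ht =>
    rw [word_mul, List.map_append, List.sum_append]
    exact T.bracket_mem _ _ _ _ hs ht

variable [LinearOrder α]

/-- The span of the values of the LS monomials with word `< m`, and of the squares of the odd LS
monomials with word `< m`, that have length `n` and letters in `F`. -/
def boundedSpan (T : LieOmegaSuperalgebra k ar L) (g : α → L) (par : α → ZMod 2) (F : Set α)
    (n : ℕ) (m : List α) : Submodule k L :=
  Submodule.span k (T.treeEval g '' ({t | IsLSMonomial (fun a b : α => a < b) t ∧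
      (∀ a ∈ word t, a ∈ F) ∧ (word t).length = n ∧ word t < m} ∪
    {t | ∃ s, t = s * s ∧ IsLSMonomial (fun a b : α => a < b) s ∧
      ((word s).map par).sum = 1 ∧
      (∀ a ∈ word s, a ∈ F) ∧ (word s).length + (word s).length = n ∧ word s < m}))

section BoundedSpan

variable (T : LieOmegaSuperalgebra k ar L) (g : α → L) (par : α → ZMod 2) (F : Set α)

theorem boundedSpan_mono (n : ℕ) {m m' : List α} (h : m ≤ m') :
    T.boundedSpan g par F n m ≤ T.boundedSpan g par F n m' := by
  refine Submodule.span_mono (Set.image_mono (Set.union_subset_union ?_ ?_))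
  · rintro t ⟨h1, h2, h3, h4⟩
    exact ⟨h1, h2, h3, h4.trans_le h⟩
  · rintro t ⟨s, h0, h1, h2, h3, h4, h5⟩
    exact ⟨s, h0, h1, h2, h3, h4, h5.trans_le h⟩

variable {T g par F} in
theorem bracket_mem_of_mem_boundedSpan {n : ℕ} {m : List α} {V : Submodule k L} {x y : L}
    (h₁ : ∀ t, IsLSMonomial (fun a b : α => a < b) t → (∀ a ∈ word t, a ∈ F) →
      (word t).length = n → word t < m → T.bracket x (T.treeEval g t) ∈ V)
    (h₂ : ∀ s, IsLSMonomial (fun a b : α => a < b) s → ((word s).map par).sum = 1 →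
      (∀ a ∈ word s, a ∈ F) → (word s).length + (word s).length = n → word s < m →
      T.bracket x (T.treeEval g (s * s)) ∈ V)
    (hy : y ∈ T.boundedSpan g par F n m) : T.bracket x y ∈ V := by
  suffices T.boundedSpan g par F n m ≤ V.comap (T.bracket x) from this hy
  refine Submodule.span_le.2 ?_
  rintro _ ⟨t, ⟨h1, h2, h3, h4⟩ | ⟨s, rfl, h1, h2, h3, h4, h5⟩, rfl⟩
  · exact h₁ t h1 h2 h3 h4
  · exact h₂ s h1 h2 h3 h4 h5

/-- Brackets of two different LS monomials, and of an LS monomial with the square of a different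
odd LS monomial, of total length `n` and with larger word `m`, are combinations of LS monomials
and squares that are bounded by `m` as in `boundedSpan`. -/
def BracketBounded (n : ℕ) (m : List α) : Prop :=
  (∀ s t, IsLSMonomial (fun a b : α => a < b) s → IsLSMonomial (fun a b : α => a < b) t →
    (∀ a ∈ word s, a ∈ F) → (∀ a ∈ word t, a ∈ F) →
    (word s).length + (word t).length = n → word s < word t → word t = m →
    T.bracket (T.treeEval g s) (T.treeEval g t) ∈ T.boundedSpan g par F n m) ∧
  (∀ s t, IsLSMonomial (fun a b : α => a < b) s → IsLSMonomial (fun a b : α => a < b) t →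
    (∀ a ∈ word s, a ∈ F) → (∀ a ∈ word t, a ∈ F) → ((word t).map par).sum = 1 →
    (word s).length + ((word t).length + (word t).length) = n →
    word s ≠ word t → max (word s) (word t) = m →
    T.bracket (T.treeEval g s) (T.treeEval g (t * t)) ∈ T.boundedSpan g par F n m)

variable [CharZero k]
variable {T g par F}

theorem bracket_mem_boundedSpan (hg : ∀ a, g a ∈ T.part (par a)) {n : ℕ} {m : List α}
    (hm : ∀ m' < m, T.BracketBounded g par F n m') {s t : FreeMagma α}
    (hs : IsLSMonomial (fun a b : α => a < b) s) (ht : IsLSMonomial (fun a b : α => a < b) t)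
    (hsF : ∀ a ∈ word s, a ∈ F) (htF : ∀ a ∈ word t, a ∈ F)
    (hn : (word s).length + (word t).length = n) (hsm : word s < m) (htm : word t < m) :
    T.bracket (T.treeEval g s) (T.treeEval g t) ∈ T.boundedSpan g par F n m := by
  rcases lt_trichotomy (word s) (word t) with h | h | h
  · exact T.boundedSpan_mono g par F n htm.le ((hm _ htm).1 s t hs ht hsF htF hn h rfl)
  · obtain rfl := hs.eq_of_word_eq ht h
    have hp := T.treeEval_mem hg s
    have h01 : ∀ i : ZMod 2, i = 0 ∨ i = 1 := by decide
    rcases h01 ((word s).map par).sum with h0 | h1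
    · rw [h0] at hp
      rw [T.bracket_self_of_even hp]
      exact zero_mem _
    · exact Submodule.subset_span ⟨s * s, Or.inr ⟨s, rfl, hs, h1, hsF, hn, hsm⟩, rfl⟩
  · refine T.bracket_swap_mem (T.treeEval_mem hg t) (T.treeEval_mem hg s) ?_
    exact T.boundedSpan_mono g par F n hsm.le
      ((hm _ hsm).1 t s ht hs htF hsF (by omega) h rfl)

theorem bracket_square_mem_boundedSpan (hg : ∀ a, g a ∈ T.part (par a)) {n : ℕ} {m : List α}
    (hm : ∀ m' < m, T.BracketBounded g par F n m') {s t : FreeMagma α}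
    (hs : IsLSMonomial (fun a b : α => a < b) s) (ht : IsLSMonomial (fun a b : α => a < b) t)
    (hsF : ∀ a ∈ word s, a ∈ F) (htF : ∀ a ∈ word t, a ∈ F)
    (hp : ((word t).map par).sum = 1)
    (hn : (word s).length + ((word t).length + (word t).length) = n)
    (hsm : word s < m) (htm : word t < m) :
    T.bracket (T.treeEval g s) (T.treeEval g (t * t)) ∈ T.boundedSpan g par F n m := by
  by_cases h : word s = word t
  · obtain rfl := hs.eq_of_word_eq ht h
    rw [treeEval_mul, T.bracket_bracket_self_of_odd (hp ▸ T.treeEval_mem hg s)]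
    exact zero_mem _
  · exact T.boundedSpan_mono g par F n (max_lt hsm htm).le
      ((hm _ (max_lt hsm htm)).2 s t hs ht hsF htF hp hn h rfl)

theorem bracketBounded_step (hg : ∀ a, g a ∈ T.part (par a)) {n : ℕ} {m : List α}
    (hn : ∀ n' < n, ∀ m, T.BracketBounded g par F n' m)
    (hm : ∀ m' < m, T.BracketBounded g par F n m') : T.BracketBounded g par F n m := by
  have len : ∀ s : FreeMagma α, 0 < (word s).length :=
    fun s => List.length_pos_iff.2 (word_ne_nil s)
  have hQ : ∀ s t, IsLSMonomial (fun a b : α => a < b) s →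
      IsLSMonomial (fun a b : α => a < b) t →
      (∀ a ∈ word s, a ∈ F) → (∀ a ∈ word t, a ∈ F) →
      (word s).length + (word t).length = n → word s < word t → word t = m →
      T.bracket (T.treeEval g s) (T.treeEval g t) ∈ T.boundedSpan g par F n m := by
    rintro s t hs ht hsF htF hl hlt rfl
    by_cases hLS : IsLSMonomial (fun a b : α => a < b) (s * t)
    · refine Submodule.subset_span ⟨s * t, Or.inl ⟨hLS, ?_, by simpa [word_mul] using hl,
        ht.isLSWord.append_lt hs.isLSWord.1 hlt⟩, rfl⟩
      intro a ha
      rw [word_mul, List.mem_append] at ha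
      exact ha.elim (hsF a) (htF a)
    · have h0 : ∃ s₁ s₂ : FreeMagma α, s = s₁ * s₂ ∧ word s₂ < word t := by
        by_contra! hcon
        exact hLS (isLSMonomial_mul_iff.2
          ⟨hs.isLSWord.append ht.isLSWord hlt, hs, ht, hcon⟩)
      obtain ⟨s₁, s₂, rfl, h2⟩ := h0
      obtain ⟨-, hs₁, hs₂, -⟩ := isLSMonomial_mul_iff.1 hs
      have h1 : word s₁ < word t := (lt_append_right _ (word_ne_nil s₂)).trans hlt
      have hF₁ : ∀ a ∈ word s₁, a ∈ F := fun a ha => hsF a (List.mem_append_left _ ha)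
      have hF₂ : ∀ a ∈ word s₂, a ∈ F := fun a ha => hsF a (List.mem_append_right _ ha)
      rw [word_mul, List.length_append] at hl
      have l1 := len s₁
      have l2 := len s₂
      refine T.bracket_bracket_mem (T.treeEval_mem hg s₁) (T.treeEval_mem hg s₂)
        (T.treeEval_mem hg t) ?_ ?_
      · refine bracket_mem_of_mem_boundedSpan (fun r hr hrF hrl hrm => ?_)
          (fun r hr hrp hrF hrl hrm => ?_) ((hn _ (by omega) _).1 s₂ t hs₂ ht hF₂ htF rfl h2 rfl)
        · exact bracket_mem_boundedSpan hg hm hs₁ hr hF₁ hrF (by omega) h1 hrm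
        · exact bracket_square_mem_boundedSpan hg hm hs₁ hr hF₁ hrF hrp (by omega) h1 hrm
      · refine bracket_mem_of_mem_boundedSpan (fun r hr hrF hrl hrm => ?_)
          (fun r hr hrp hrF hrl hrm => ?_) ((hn _ (by omega) _).1 s₁ t hs₁ ht hF₁ htF rfl h1 rfl)
        · exact bracket_mem_boundedSpan hg hm hs₂ hr hF₂ hrF (by omega) h2 hrm
        · exact bracket_square_mem_boundedSpan hg hm hs₂ hr hF₂ hrF hrp (by omega) h2 hrm
  -- The square is of the smaller monomial `t`: all brackets that arise stay below `m = s`.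
  have hR : ∀ s t, IsLSMonomial (fun a b : α => a < b) s →
      IsLSMonomial (fun a b : α => a < b) t →
      (∀ a ∈ word s, a ∈ F) → (∀ a ∈ word t, a ∈ F) → ((word t).map par).sum = 1 →
      (word s).length + ((word t).length + (word t).length) = n →
      word t < word s → word s = m →
      T.bracket (T.treeEval g s) (T.treeEval g (t * t)) ∈ T.boundedSpan g par F n m := by
    rintro s t hs ht hsF htF hp hl hlt rfl
    have l1 := len t
    refine T.bracket_square_mem (T.treeEval_mem hg s) (T.treeEval_mem hg t) ?_
    refine bracket_mem_of_mem_boundedSpan (fun r hr hrF hrl hrm => ?_)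
      (fun r hr hrp hrF hrl hrm => ?_)
      (T.bracket_swap_mem (T.treeEval_mem hg t) (T.treeEval_mem hg s)
        ((hn _ (by omega) _).1 t s ht hs htF hsF rfl hlt rfl))
    · exact bracket_mem_boundedSpan hg hm ht hr htF hrF (by omega) hlt hrm
    · exact bracket_square_mem_boundedSpan hg hm ht hr htF hrF hrp (by omega) hlt hrm
  refine ⟨hQ, fun s t hs ht hsF htF hp hl hne hmax => ?_⟩
  rcases lt_or_gt_of_ne hne with hlt | hlt
  · rw [max_eq_right hlt.le] at hmax
    subst hmax
    have l1 := len t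
    -- The brackets that arise have the larger word `m = t` again, but are covered above.
    refine T.bracket_square_mem (T.treeEval_mem hg s) (T.treeEval_mem hg t) ?_
    refine bracket_mem_of_mem_boundedSpan (fun r hr hrF hrl hrm => ?_)
      (fun r hr hrp hrF hrl hrm => ?_) ((hn _ (by omega) _).1 s t hs ht hsF htF rfl hlt rfl)
    · exact T.bracket_swap_mem (T.treeEval_mem hg r) (T.treeEval_mem hg t)
        (hQ r t hr ht hrF htF (by omega) hrm rfl)
    · exact hR t r ht hr htF hrF hrp (by omega) hrm rfl
  · rw [max_eq_left hlt.le] at hmax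
    exact hR s t hs ht hsF htF hp hl hlt hmax

theorem bracketBounded (hg : ∀ a, g a ∈ T.part (par a)) (hF : F.Finite) (n : ℕ) (m : List α) :
    T.BracketBounded g par F n m := by
  induction n using Nat.strong_induction_on generalizing m with
  | h n hn =>
    -- Only the finitely many words of length `< n` in the letters of `F` matter.
    let W : Set (List α) := {l | l.length < n ∧ ∀ a ∈ l, a ∈ F}
    have hW : W.Finite := by
      have := hF.to_subtype
      refine ((List.finite_length_lt F n).image (List.map Subtype.val)).subset ?_
      rintro l ⟨hl, hlF⟩
      exact ⟨l.attachWith _ hlF, by simpa using hl, by simp⟩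
    have hout : ∀ m ∉ W, T.BracketBounded g par F n m := by
      refine fun m hmW => ⟨?_, ?_⟩
      · rintro s t - - - htF hl - rfl
        have := List.length_pos_iff.2 (word_ne_nil s)
        exact absurd ⟨by omega, htF⟩ hmW
      · rintro s t - - hsF htF - hl - rfl
        have := List.length_pos_iff.2 (word_ne_nil s)
        have := List.length_pos_iff.2 (word_ne_nil t)
        rcases max_choice (word s) (word t) with h | h
        · rw [h] at hmW
          exact absurd ⟨by omega, hsF⟩ hmW
        · rw [h] at hmW
          exact absurd ⟨by omega, htF⟩ hmW
    by_cases hmW : m ∈ W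
    · refine (hW.wellFoundedOn (r := (· < ·))).induction hmW fun m _ ih => ?_
      refine bracketBounded_step hg hn fun m' hm' => ?_
      by_cases h : m' ∈ W
      · exact ih m' h hm'
      · exact hout m' h
    · exact hout m hmW

end BoundedSpan

section Span

variable (T : LieOmegaSuperalgebra k ar L) {g : α → L} {par : α → ZMod 2}

theorem boundedSpan_le (g : α → L) (par : α → ZMod 2) (F : Set α) (n : ℕ) (m : List α) :
    T.boundedSpan g par F n m ≤ Submodule.span k (T.treeEval g ''
      {t | IsSLSMonomial (fun a b : α => a < b) par t}) := by
  refine Submodule.span_mono (Set.image_mono ?_)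
  rintro t (⟨h, -⟩ | ⟨s, rfl, h, hp, -⟩)
  · exact Or.inl h
  · exact Or.inr ⟨s, rfl, h, hp⟩

/-- In characteristic zero the values of the super-Lyndon-Shirshov monomials span a subspace
that is closed under the bracket. -/
theorem bracket_mem_span_sls [CharZero k] (hg : ∀ a, g a ∈ T.part (par a)) {x y : L}
    (hx : x ∈ Submodule.span k (T.treeEval g ''
      {t | IsSLSMonomial (fun a b : α => a < b) par t}))
    (hy : y ∈ Submodule.span k (T.treeEval g ''
      {t | IsSLSMonomial (fun a b : α => a < b) par t})) :
    T.bracket x y ∈ Submodule.span k (T.treeEval g ''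
      {t | IsSLSMonomial (fun a b : α => a < b) par t}) := by
  set V := Submodule.span k (T.treeEval g ''
      {t | IsSLSMonomial (fun a b : α => a < b) par t}) with hV
  have hLL : ∀ s t, IsLSMonomial (fun a b : α => a < b) s →
      IsLSMonomial (fun a b : α => a < b) t →
      T.bracket (T.treeEval g s) (T.treeEval g t) ∈ V := by
    intro s t hs ht
    have hF : {a | a ∈ word s ++ word t}.Finite := List.finite_toSet _
    by_cases h : word s = word t
    · obtain rfl := hs.eq_of_word_eq ht h
      have hp := T.treeEval_mem hg s
      have h01 : ∀ i : ZMod 2, i = 0 ∨ i = 1 := by decide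
      rcases h01 ((word s).map par).sum with h0 | h1
      · rw [h0] at hp
        rw [T.bracket_self_of_even hp]
        exact zero_mem _
      · exact Submodule.subset_span ⟨s * s, Or.inr ⟨s, rfl, hs, h1⟩, rfl⟩
    · rcases lt_or_gt_of_ne h with h | h
      · exact T.boundedSpan_le g par _ _ _ ((bracketBounded hg hF _ _).1 s t hs ht
          (fun a ha => List.mem_append_left _ ha) (fun a ha => List.mem_append_right _ ha)
          rfl h rfl)
      · exact T.bracket_swap_mem (T.treeEval_mem hg t) (T.treeEval_mem hg s)
          (T.boundedSpan_le g par _ _ _ ((bracketBounded hg hF _ _).1 t s ht hs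
          (fun a ha => List.mem_append_right _ ha) (fun a ha => List.mem_append_left _ ha)
          rfl h rfl))
  have hLS : ∀ s t, IsLSMonomial (fun a b : α => a < b) s →
      IsLSMonomial (fun a b : α => a < b) t → ((word t).map par).sum = 1 →
      T.bracket (T.treeEval g s) (T.treeEval g (t * t)) ∈ V := by
    intro s t hs ht hp
    have hF : {a | a ∈ word s ++ word t}.Finite := List.finite_toSet _
    by_cases h : word s = word t
    · obtain rfl := hs.eq_of_word_eq ht h
      rw [treeEval_mul, T.bracket_bracket_self_of_odd (hp ▸ T.treeEval_mem hg s)]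
      exact zero_mem _
    · exact T.boundedSpan_le g par _ _ _ ((bracketBounded hg hF _ _).2 s t hs ht
        (fun a ha => List.mem_append_left _ ha) (fun a ha => List.mem_append_right _ ha)
        hp rfl h rfl)
  have hL : ∀ s, IsLSMonomial (fun a b : α => a < b) s → ∀ y ∈ V,
      T.bracket (T.treeEval g s) y ∈ V := by
    intro s hs y hy
    suffices V ≤ V.comap (T.bracket (T.treeEval g s)) from this hy
    refine Submodule.span_le.2 ?_
    rintro _ ⟨t, ht | ⟨t, rfl, ht, hp⟩, rfl⟩
    · exact hLL s t hs ht
    · exact hLS s t hs ht hp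
  suffices V ≤ V.comap (T.bracket.flip y) from this hx
  refine Submodule.span_le.2 ?_
  rintro _ ⟨s, hs | ⟨s, rfl, hs, -⟩, rfl⟩
  · exact hL s hs y hy
  · suffices V ≤ V.comap (T.bracket (T.treeEval g (s * s))) from this hy
    refine Submodule.span_le.2 ?_
    rintro _ ⟨t, ht, rfl⟩
    have hs' := T.treeEval_mem hg s
    have h := hL s hs _ (hL s hs _ (Submodule.subset_span ⟨t, ht, rfl⟩))
    exact T.bracket_bracket_mem hs' hs' (T.treeEval_mem hg t) h h

end Span

end LieOmegaSuperalgebra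

/-! ### The Deg-lex order on associative `Ω`-words -/

section DegLex

variable {Ω : Type v} {ar : Ω → ℕ} {X : Type u}

theorem OmegaPrime.deg_pos (p : OmegaPrime ar X) : 0 < p.deg := by
  cases p <;> simp only [OmegaPrime.deg] <;> omega

theorem OmegaWord.deg_pos (s : OmegaWord ar X) : 0 < s.deg := by
  cases s with
  | single p => simpa only [OmegaWord.deg] using p.deg_pos
  | cons p s =>
    have := p.deg_pos
    simp only [OmegaWord.deg]
    omega

theorem OmegaPrime.one_lt_deg_op {ω : Ω} (h : 1 ≤ ar ω) (a : Fin (ar ω) → OmegaWord ar X) :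
    1 < (OmegaPrime.op ω a).deg := by
  have h1 : (a ⟨0, h⟩).deg ≤ ∑ i, (a i).deg :=
    Finset.single_le_sum (f := fun i => (a i).deg) (fun _ _ => Nat.zero_le _) (Finset.mem_univ _)
  have := (a ⟨0, h⟩).deg_pos
  simp only [OmegaPrime.deg]
  omega

theorem OmegaWord.deg_mul (s t : OmegaWord ar X) : (s * t).deg = s.deg + t.deg := by
  change (s.append t).deg = _
  match s with
  | .single p => simp only [OmegaWord.append, OmegaWord.deg]
  | .cons p s =>
    simp only [OmegaWord.append, OmegaWord.deg]
    rw [add_assoc]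
    exact congrArg _ (OmegaWord.deg_mul s t)

theorem OmegaWord.bre_mul (s t : OmegaWord ar X) : (s * t).bre = s.bre + t.bre := by
  change (s.append t).bre = _
  match s with
  | .single p => simp only [OmegaWord.append, OmegaWord.bre]
  | .cons p s =>
    simp only [OmegaWord.append, OmegaWord.bre]
    rw [add_assoc]
    exact congrArg _ (OmegaWord.bre_mul s t)

/-- The sequence of prime factors of a word. -/
def OmegaWord.toList : OmegaWord ar X → List (OmegaPrime ar X)
  | .single p => [p]
  | .cons p s => p :: s.toList

theorem OmegaWord.toList_ne_nil (s : OmegaWord ar X) : s.toList ≠ [] := by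
  cases s <;> simp [OmegaWord.toList]

theorem OmegaWord.toList_mul (s t : OmegaWord ar X) : (s * t).toList = s.toList ++ t.toList := by
  change (s.append t).toList = _
  match s with
  | .single p => simp only [OmegaWord.append, OmegaWord.toList, List.singleton_append]
  | .cons p s =>
    simp only [OmegaWord.append, OmegaWord.toList, List.cons_append]
    exact congrArg _ (OmegaWord.toList_mul s t)

theorem OmegaWord.length_toList (s : OmegaWord ar X) : s.toList.length = s.bre := by
  match s with
  | .single p => rfl
  | .cons p s =>
    simp only [OmegaWord.toList, OmegaWord.bre, List.length_cons]
    rw [OmegaWord.length_toList s, add_comm]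

theorem OmegaWord.toList_injective :
    Function.Injective (OmegaWord.toList : OmegaWord ar X → List (OmegaPrime ar X)) := by
  intro s t h
  match s, t with
  | .single p, .single q => simpa [OmegaWord.toList] using h
  | .single p, .cons q t =>
    simp only [OmegaWord.toList, List.cons.injEq] at h
    exact absurd h.2.symm t.toList_ne_nil
  | .cons p s, .single q =>
    simp only [OmegaWord.toList, List.cons.injEq] at h
    exact absurd h.2 s.toList_ne_nil
  | .cons p s, .cons q t =>
    simp only [OmegaWord.toList, List.cons.injEq] at h
    rw [h.1, OmegaWord.toList_injective h.2]

variable [LinearOrder X] [LinearOrder Ω]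

theorem OmegaPrime.LT.deg_le {p q : OmegaPrime ar X} (h : OmegaPrime.LT p q) :
    p.deg ≤ q.deg := by
  cases h with
  | deg h => exact h.le
  | var => simp [OmegaPrime.deg]
  | op h _ => exact h.le
  | args _ h => exact h.le

theorem OmegaWord.DegLexLT.trans_of_lexLT {r s t : OmegaWord ar X}
    (h : OmegaWord.LexLT r s → OmegaWord.LexLT s t → OmegaWord.LexLT r t)
    (h₁ : OmegaWord.DegLexLT r s) (h₂ : OmegaWord.DegLexLT s t) : OmegaWord.DegLexLT r t := by
  cases h₁ with
  | deg h1 =>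
    cases h₂ with
    | deg h2 => exact .deg (h1.trans h2)
    | bre h2 _ => exact .deg (h2 ▸ h1)
    | lex h2 _ _ => exact .deg (h2 ▸ h1)
  | bre h1 h1' =>
    cases h₂ with
    | deg h2 => exact .deg (h1 ▸ h2)
    | bre h2 h2' => exact .bre (h1.trans h2) (h1'.trans h2')
    | lex h2 h2' _ => exact .bre (h1.trans h2) (h2' ▸ h1')
  | lex h1 h1' h1'' =>
    cases h₂ with
    | deg h2 => exact .deg (h1 ▸ h2)
    | bre h2 h2' => exact .bre (h1.trans h2) (h1' ▸ h2')
    | lex h2 h2' h2'' => exact .lex (h1.trans h2) (h1'.trans h2') (h h1'' h2'')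

mutual

theorem OmegaPrime.LT.irrefl (p : OmegaPrime ar X) : ¬ OmegaPrime.LT p p := by
  intro h
  match p with
  | .var x =>
    cases h with
    | deg h => exact lt_irrefl _ h
    | var h => exact lt_irrefl _ h
  | .op ω a =>
    cases h with
    | deg h => exact lt_irrefl _ h
    | op _ h => exact lt_irrefl _ h
    | args i _ _ h =>
      cases h with
      | deg h => exact lt_irrefl _ h
      | bre _ h => exact lt_irrefl _ h
      | lex _ _ h => exact OmegaWord.LexLT.irrefl (a i) h

theorem OmegaWord.LexLT.irrefl (s : OmegaWord ar X) : ¬ OmegaWord.LexLT s s := by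
  intro h
  match s with
  | .single p =>
    cases h with
    | single h => exact OmegaPrime.LT.irrefl p h
  | .cons p s =>
    cases h with
    | head h => exact OmegaPrime.LT.irrefl p h
    | tail h => exact OmegaWord.LexLT.irrefl s h

end

mutual

theorem OmegaPrime.LT.trans' (p q r : OmegaPrime ar X) (h₁ : OmegaPrime.LT p q)
    (h₂ : OmegaPrime.LT q r) : OmegaPrime.LT p r := by
  match p with
  | .var x =>
    cases h₁ with
    | deg h => exact .deg (h.trans_le h₂.deg_le)
    | var h =>
      cases h₂ with
      | deg h' => exact .deg (by simpa only [OmegaPrime.deg] using h')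
      | var h' => exact .var (h.trans h')
  | .op ω a =>
    cases h₁ with
    | deg h => exact .deg (h.trans_le h₂.deg_le)
    | op h1 h1' =>
      cases h₂ with
      | deg h => exact .deg (h1 ▸ h)
      | op h2 h2' => exact .op (h1.trans h2) (h1'.trans h2')
      | args j h2 h2' _ => exact .op (h1.trans h2) h1'
    | args i h1 h1' h1'' =>
      cases h₂ with
      | deg h => exact .deg (h1 ▸ h)
      | op h2 h2' => exact .op (h1.trans h2) h2'
      | args j h2 h2' h2'' =>
        rcases lt_trichotomy i j with hij | rfl | hij
        · exact .args i (h1.trans h2) (fun l hl => (h1' l hl).trans (h2' l (hl.trans hij)))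
            (h2' i hij ▸ h1'')
        · exact .args i (h1.trans h2) (fun l hl => (h1' l hl).trans (h2' l hl))
            (.trans_of_lexLT (OmegaWord.LexLT.trans' (a i) _ _) h1'' h2'')
        · exact .args j (h1.trans h2) (fun l hl => (h1' l (hl.trans hij)).trans (h2' l hl))
            (h1' j hij ▸ h2'')

theorem OmegaWord.LexLT.trans' (r s t : OmegaWord ar X) (h₁ : OmegaWord.LexLT r s)
    (h₂ : OmegaWord.LexLT s t) : OmegaWord.LexLT r t := by
  match r with
  | .single p =>
    cases h₁ with
    | single h =>
      cases h₂ with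
      | single h' => exact .single (OmegaPrime.LT.trans' p _ _ h h')
  | .cons p r =>
    cases h₁ with
    | head h =>
      cases h₂ with
      | head h' => exact .head (OmegaPrime.LT.trans' p _ _ h h')
      | tail h' => exact .head h
    | tail h =>
      cases h₂ with
      | head h' => exact .head h'
      | tail h' => exact .tail (OmegaWord.LexLT.trans' r _ _ h h')

end

theorem OmegaWord.DegLexLT.trichotomous_of_lexLT {s t : OmegaWord ar X}
    (h : s.bre = t.bre → OmegaWord.LexLT s t ∨ s = t ∨ OmegaWord.LexLT t s) :
    OmegaWord.DegLexLT s t ∨ s = t ∨ OmegaWord.DegLexLT t s := by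
  rcases lt_trichotomy s.deg t.deg with h1 | h1 | h1
  · exact Or.inl (.deg h1)
  · rcases lt_trichotomy s.bre t.bre with h2 | h2 | h2
    · exact Or.inl (.bre h1 h2)
    · rcases h h2 with h3 | h3 | h3
      · exact Or.inl (.lex h1 h2 h3)
      · exact Or.inr (Or.inl h3)
      · exact Or.inr (Or.inr (.lex h1.symm h2.symm h3))
    · exact Or.inr (Or.inr (.bre h1.symm h2))
  · exact Or.inr (Or.inr (.deg h1))

mutual

/-- The arities have to be positive: a constant would have the degree of a letter. -/
theorem OmegaPrime.LT.trichotomous (har : ∀ ω, 1 ≤ ar ω) (p q : OmegaPrime ar X) :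
    OmegaPrime.LT p q ∨ p = q ∨ OmegaPrime.LT q p := by
  rcases lt_trichotomy p.deg q.deg with h | h | h
  · exact Or.inl (.deg h)
  · match p with
    | .var x =>
      cases q with
      | var y =>
        rcases lt_trichotomy x y with h | h | h
        · exact Or.inl (.var h)
        · exact Or.inr (Or.inl (h ▸ rfl))
        · exact Or.inr (Or.inr (.var h))
      | op θ b =>
        exact absurd (OmegaPrime.one_lt_deg_op (har θ) b) (by rw [← h]; simp [OmegaPrime.deg])
    | .op ω a =>
      cases q with
      | var y =>
        exact absurd (OmegaPrime.one_lt_deg_op (har ω) a) (by rw [h]; simp [OmegaPrime.deg])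
      | op θ b =>
        rcases lt_trichotomy ω θ with h1 | h1 | h1
        · exact Or.inl (.op h h1)
        · subst h1
          by_cases hab : a = b
          · exact Or.inr (Or.inl (hab ▸ rfl))
          · -- compare at the first argument in which the two words differ
            obtain ⟨i, hi, hmin⟩ := WellFounded.has_min (wellFounded_lt (α := Fin (ar ω)))
              {i | a i ≠ b i} (Function.ne_iff.1 hab)
            have heq : ∀ j < i, a j = b j := fun j hj => by
              by_contra hne
              exact hmin j hne hj
            rcases OmegaWord.DegLexLT.trichotomous_of_lexLT
              (OmegaWord.LexLT.trichotomous har (a i) (b i)) with h2 | h2 | h2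
            · exact Or.inl (.args i h heq h2)
            · exact absurd h2 hi
            · exact Or.inr (Or.inr (.args i h.symm (fun j hj => (heq j hj).symm) h2))
        · exact Or.inr (Or.inr (.op h.symm h1))
  · exact Or.inr (Or.inr (.deg h))

theorem OmegaWord.LexLT.trichotomous (har : ∀ ω, 1 ≤ ar ω) (s t : OmegaWord ar X)
    (hb : s.bre = t.bre) : OmegaWord.LexLT s t ∨ s = t ∨ OmegaWord.LexLT t s := by
  match s with
  | .single p =>
    cases t with
    | single q =>
      rcases OmegaPrime.LT.trichotomous har p q with h | h | h
      · exact Or.inl (.single h)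
      · exact Or.inr (Or.inl (h ▸ rfl))
      · exact Or.inr (Or.inr (.single h))
    | cons q t =>
      have := List.length_pos_iff.2 t.toList_ne_nil
      rw [OmegaWord.length_toList] at this
      simp only [OmegaWord.bre] at hb
      omega
  | .cons p s =>
    cases t with
    | single q =>
      have := List.length_pos_iff.2 s.toList_ne_nil
      rw [OmegaWord.length_toList] at this
      simp only [OmegaWord.bre] at hb
      omega
    | cons q t =>
      rcases OmegaPrime.LT.trichotomous har p q with h | h | h
      · exact Or.inl (.head h)
      · subst h
        rcases OmegaWord.LexLT.trichotomous har s t (by simpa [OmegaWord.bre] using hb)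
          with h | h | h
        · exact Or.inl (.tail h)
        · exact Or.inr (Or.inl (h ▸ rfl))
        · exact Or.inr (Or.inr (.tail h))
      · exact Or.inr (Or.inr (.head h))

end

/-- The Deg-lex order as a linear order. -/
noncomputable abbrev OmegaWord.degLexOrder (har : ∀ ω, 1 ≤ ar ω) :
    LinearOrder (OmegaWord ar X) :=
  have : IsStrictTotalOrder (OmegaWord ar X) OmegaWord.DegLexLT :=
    { irrefl := fun s h => by
        cases h with
        | deg h => exact lt_irrefl _ h
        | bre _ h => exact lt_irrefl _ h
        | lex _ _ h => exact OmegaWord.LexLT.irrefl s h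
      trans := fun _ _ _ => .trans_of_lexLT (OmegaWord.LexLT.trans' _ _ _)
      trichotomous := fun s t h1 h2 =>
        ((OmegaWord.DegLexLT.trichotomous_of_lexLT
          (OmegaWord.LexLT.trichotomous har s t)).resolve_left h1).resolve_right h2 }
  open Classical in linearOrderOfSTO OmegaWord.DegLexLT

theorem OmegaWord.LexLT.mul_right {s t r r' : OmegaWord ar X} (h : OmegaWord.LexLT s t) :
    OmegaWord.LexLT (s * r) (t * r') := by
  match h with
  | .single h => exact .head h
  | .head h => exact .head h
  | .tail h => exact .tail h.mul_right

theorem OmegaWord.LexLT.mul_left {s t : OmegaWord ar X} (r : OmegaWord ar X)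
    (h : OmegaWord.LexLT s t) : OmegaWord.LexLT (r * s) (r * t) := by
  match r with
  | .single p => exact .tail h
  | .cons p r => exact .tail (h.mul_left r)

end DegLex

/-! ### Renaming of letters -/

namespace SuperLyndon

section Map

variable {α : Type*} {β : Type*} {f : α → β} {gt : α → α → Prop} {gt' : β → β → Prop}

theorem word_map (f : α → β) (t : FreeMagma α) : word (FreeMagma.map f t) = (word t).map f := by
  induction t with
  | ih1 a => rfl
  | ih2 s t hs ht => rw [map_mul, word_mul, word_mul, hs, ht, List.map_append]

theorem lexGT_map_iff (hf : Function.Injective f) (hgt : ∀ a b, gt' (f a) (f b) ↔ gt a b)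
    (s t : List α) : LexGT gt' (s.map f) (t.map f) ↔ LexGT gt s t := by
  induction s generalizing t with
  | nil => cases t <;> simp [LexGT]
  | cons a s ih => cases t <;> simp [LexGT, hgt, hf.eq_iff, ih]

theorem isLSWord_map_iff (hf : Function.Injective f) (hgt : ∀ a b, gt' (f a) (f b) ↔ gt a b)
    (s : List α) : IsLSWord gt' (s.map f) ↔ IsLSWord gt s := by
  refine and_congr (by simp) ⟨fun h v w hv hw he => ?_, fun h v w hv hw he => ?_⟩
  · have := h (v.map f) (w.map f) (by simpa using hv) (by simpa using hw) (by simp [he])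
    rwa [← List.map_append, lexGT_map_iff hf hgt] at this
  · obtain ⟨v, w, rfl, rfl, rfl⟩ := List.map_eq_append_iff.1 he
    rw [← List.map_append, lexGT_map_iff hf hgt]
    exact h v w (by simpa using hv) (by simpa using hw) rfl

theorem isLSMonomial_map_iff (hf : Function.Injective f) (hgt : ∀ a b, gt' (f a) (f b) ↔ gt a b)
    (t : FreeMagma α) : IsLSMonomial gt' (FreeMagma.map f t) ↔ IsLSMonomial gt t := by
  induction t with
  | ih1 a => exact isLSWord_map_iff hf hgt [a]
  | ih2 s t hs ht =>
    rw [map_mul]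
    change (_ ∧ _ ∧ _ ∧ _) ↔ (_ ∧ _ ∧ _ ∧ _)
    rw [word_map, word_map, ← List.map_append, isLSWord_map_iff hf hgt, hs, ht]
    refine and_congr_right fun _ => and_congr_right fun _ => and_congr_right fun _ =>
      ⟨fun h s₁ s₂ he => ?_, fun h s₁ s₂ he => ?_⟩
    · have := h (FreeMagma.map f s₁) (FreeMagma.map f s₂) (by rw [he, map_mul])
      rwa [word_map, lexGT_map_iff hf hgt, (List.map_injective_iff.2 hf).eq_iff] at this
    · cases s with
      | of a => cases he
      | mul r₁ r₂ =>
        change FreeMagma.map f r₁ * FreeMagma.map f r₂ = s₁ * s₂ at he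
        injection he with h1 h2
        rw [← h2, word_map, lexGT_map_iff hf hgt, (List.map_injective_iff.2 hf).eq_iff]
        exact h r₁ r₂ rfl

theorem IsSLSMonomial.map (hf : Function.Injective f) (hgt : ∀ a b, gt' (f a) (f b) ↔ gt a b)
    {par : α → ZMod 2} {par' : β → ZMod 2} (hpar : ∀ a, par' (f a) = par a)
    {t : FreeMagma α} (h : IsSLSMonomial gt par t) :
    IsSLSMonomial gt' par' (FreeMagma.map f t) := by
  rcases h with h | ⟨s, rfl, h, hp⟩
  · exact Or.inl ((isLSMonomial_map_iff hf hgt t).2 h)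
  · refine Or.inr ⟨FreeMagma.map f s, map_mul _ _ _, (isLSMonomial_map_iff hf hgt s).2 h, ?_⟩
    rw [word_map, List.map_map, ← hp]
    exact congrArg (fun g => (List.map g (word s)).sum) (funext hpar)

theorem IsSLSMonomial.of_map (hf : Function.Injective f)
    (hgt : ∀ a b, gt' (f a) (f b) ↔ gt a b)
    {par : α → ZMod 2} {par' : β → ZMod 2} (hpar : ∀ a, par' (f a) = par a)
    {t : FreeMagma α} (h : IsSLSMonomial gt' par' (FreeMagma.map f t)) :
    IsSLSMonomial gt par t := by
  rcases h with h | ⟨s, hs, h, hp⟩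
  · exact Or.inl ((isLSMonomial_map_iff hf hgt t).1 h)
  · cases t with
    | of a => cases hs
    | mul t₁ t₂ =>
      change FreeMagma.map f t₁ * FreeMagma.map f t₂ = s * s at hs
      injection hs with h1 h2
      have hinj : ∀ r₁ r₂ : FreeMagma α, FreeMagma.map f r₁ = FreeMagma.map f r₂ → r₁ = r₂ := by
        intro r₁
        induction r₁ with
        | ih1 a =>
          intro r₂ h
          cases r₂ with
          | of b => injection h with h; rw [hf h]
          | mul _ _ => cases h
        | ih2 x y hx hy =>
          intro r₂ h
          cases r₂ with
          | of b => cases h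
          | mul x' y' =>
            change FreeMagma.map f x * FreeMagma.map f y =
              FreeMagma.map f x' * FreeMagma.map f y' at h
            injection h with h h'
            rw [hx _ h, hy _ h']; rfl
      obtain rfl := hinj _ _ (h1.trans h2.symm)
      subst h1
      refine Or.inr ⟨t₁, rfl, (isLSMonomial_map_iff hf hgt t₁).1 h, ?_⟩
      rw [word_map, List.map_map] at hp
      rw [← hp]
      exact congrArg (fun g => (List.map g (word t₁)).sum) (funext fun a => (hpar a).symm)

end Map

end SuperLyndon

/-! ### The set of super-Lyndon-Shirshov `Ω`-monomials -/

namespace OmegaMonomial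

open SuperLyndon

variable {Ω : Type v} {ar : Ω → ℕ} {X : Type u}

/-- The variables, and the operators applied to elements of `Y`. -/
def opLetters (Y : Set (OmegaMonomial ar X)) : Set (OmegaMonomial ar X) :=
  Set.range OmegaMonomial.var ∪
    {m | ∃ (ω : Ω) (a : Fin (ar ω) → OmegaMonomial ar X), (∀ i, a i ∈ Y) ∧ m = .op ω a}

theorem opLetters_mono {Y Z : Set (OmegaMonomial ar X)} (h : Y ⊆ Z) :
    opLetters Y ⊆ opLetters Z := by
  refine Set.union_subset_union_right _ ?_
  rintro m ⟨ω, a, ha, rfl⟩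
  exact ⟨ω, a, fun i => h (ha i), rfl⟩

theorem opLetters_iUnion {Y : ℕ → Set (OmegaMonomial ar X)} (hY : Monotone Y) :
    opLetters (⋃ n, Y n) ⊆ ⋃ n, opLetters (Y n) := by
  rintro m (hm | ⟨ω, a, ha, rfl⟩)
  · exact Set.mem_iUnion.2 ⟨0, Or.inl hm⟩
  · choose n hn using fun i => Set.mem_iUnion.1 (ha i)
    exact Set.mem_iUnion.2 ⟨Finset.univ.sup n, Or.inr
      ⟨ω, a, fun i => hY (Finset.le_sup (Finset.mem_univ i)) (hn i), rfl⟩⟩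

theorem exists_toWord_eq_single {Y : Set (OmegaMonomial ar X)} (a : opLetters Y) :
    ∃ p, a.1.toWord = .single p := by
  obtain ⟨_, ⟨x, rfl⟩ | ⟨ω, a, -, rfl⟩⟩ := a
  · exact ⟨_, rfl⟩
  · exact ⟨_, rfl⟩

theorem injOn_toWord_opLetters {Y : Set (OmegaMonomial ar X)} (hY : Set.InjOn toWord Y) :
    Set.InjOn toWord (opLetters Y) := by
  rintro _ (⟨x, rfl⟩ | ⟨ω, a, ha, rfl⟩) _ (⟨y, rfl⟩ | ⟨θ, b, hb, rfl⟩) h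
  · simp only [toWord, OmegaWord.single.injEq, OmegaPrime.var.injEq] at h
    rw [h]
  · simp [toWord] at h
  · simp [toWord] at h
  · simp only [toWord, OmegaWord.single.injEq, OmegaPrime.op.injEq] at h
    obtain ⟨rfl, h⟩ := h
    rw [heq_eq_eq] at h
    rw [show a = b from funext fun i => hY (ha i) (hb i) (congrFun h i)]

theorem toList_toWord_lift {S : Set (OmegaMonomial ar X)} {p : S → OmegaPrime ar X}
    (hp : ∀ a : S, a.1.toWord = .single (p a)) (t : FreeMagma S) :
    (FreeMagma.lift (fun a : S => a.1) t).toWord.toList = (word t).map p := by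
  induction t with
  | ih1 a => simp [hp, word, OmegaWord.toList]
  | ih2 s t hs ht =>
    rw [map_mul, word_mul, List.map_append, ← hs, ← ht]
    exact OmegaWord.toList_mul _ _

variable [LinearOrder X] [LinearOrder Ω]

/-- The reverse Deg-lex order on a set of letters with distinct underlying words. It turns the
lexicographic order with greatest element the empty word into the reverse of the usual one. -/
noncomputable abbrev letterOrder (har : ∀ ω, 1 ≤ ar ω) {S : Set (OmegaMonomial ar X)}
    (hS : Set.InjOn toWord S) : LinearOrder S :=
  have : IsStrictTotalOrder S (fun a b : S => OmegaWord.DegLexLT b.1.toWord a.1.toWord) :=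
    letI := OmegaWord.degLexOrder (X := X) har
    { irrefl := fun s h => lt_irrefl s.1.toWord h
      trans := fun _ _ _ h1 h2 => lt_trans (α := OmegaWord ar X) h2 h1
      trichotomous := fun s t h1 h2 =>
        Subtype.ext (hS s.2 t.2 (le_antisymm (not_lt.1 h1) (not_lt.1 h2))) }
  open Classical in
  linearOrderOfSTO (fun a b : S => OmegaWord.DegLexLT b.1.toWord a.1.toWord)

theorem injOn_toWord_slsOn (har : ∀ ω, 1 ≤ ar ω) (par : X → ZMod 2)
    {Y : Set (OmegaMonomial ar X)} (hY : Set.InjOn toWord Y) :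
    Set.InjOn toWord (slsOn par (opLetters Y)) := by
  rintro _ ⟨s, hs, rfl⟩ _ ⟨t, ht, rfl⟩ h
  have hS := injOn_toWord_opLetters hY
  choose p hp using exists_toWord_eq_single (Y := Y)
  have hpinj : Function.Injective p := fun a b hab =>
    Subtype.ext (hS a.2 b.2 (by rw [hp, hp, hab]))
  have h := congrArg OmegaWord.toList h
  rw [toList_toWord_lift hp, toList_toWord_lift hp, (List.map_injective_iff.2 hpinj).eq_iff] at h
  let := letterOrder har hS
  rw [IsSLSMonomial.eq_of_word_eq hs ht h]

theorem slsOn_mono (par : X → ZMod 2) {S S' : Set (OmegaMonomial ar X)} (h : S ⊆ S') :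
    slsOn par S ⊆ slsOn par S' := by
  rintro _ ⟨t, ht, rfl⟩
  refine ⟨FreeMagma.map (Set.inclusion h) t,
    ht.map (Set.inclusion_injective h) (fun _ _ => Iff.rfl) (fun _ => rfl), ?_⟩
  clear ht
  induction t with
  | ih1 a => rfl
  | ih2 s t hs ht => rw [map_mul, map_mul, map_mul, hs, ht]

theorem slsOn_iUnion (par : X → ZMod 2) {S : ℕ → Set (OmegaMonomial ar X)} (hS : Monotone S) :
    slsOn par (⋃ n, S n) ⊆ ⋃ n, slsOn par (S n) := by
  rintro _ ⟨t, ht, rfl⟩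
  have key : ∀ t : FreeMagma ↥(⋃ n, S n), ∃ n, ∀ m, n ≤ m →
      ∃ t' : FreeMagma (S m), FreeMagma.map (Set.inclusion (Set.subset_iUnion S m)) t' = t := by
    intro t
    induction t with
    | ih1 a =>
      obtain ⟨n, hn⟩ := Set.mem_iUnion.1 a.2
      exact ⟨n, fun m hm => ⟨.of ⟨a.1, hS hm hn⟩, rfl⟩⟩
    | ih2 s t hs ht =>
      obtain ⟨n, hn⟩ := hs
      obtain ⟨n', hn'⟩ := ht
      refine ⟨max n n', fun m hm => ?_⟩
      obtain ⟨s', hs'⟩ := hn m ((le_max_left _ _).trans hm)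
      obtain ⟨t', ht'⟩ := hn' m ((le_max_right _ _).trans hm)
      exact ⟨s' * t', by rw [map_mul, hs', ht']⟩
  obtain ⟨n, hn⟩ := key t
  obtain ⟨t, rfl⟩ := hn n le_rfl
  refine Set.mem_iUnion.2 ⟨n, t, ht.of_map (Set.inclusion_injective _) (fun _ _ => Iff.rfl)
    (fun _ => rfl), ?_⟩
  clear ht hn
  induction t with
  | ih1 a => rfl
  | ih2 s t hs ht => rw [map_mul, map_mul, map_mul, hs, ht]

theorem slsmLevel_mono (par : X → ZMod 2) : Monotone (slsmLevel (X := X) ar par) := by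
  refine monotone_nat_of_le_succ fun n => ?_
  induction n with
  | zero => exact slsOn_mono par Set.subset_union_left
  | succ n ih => exact slsOn_mono par (opLetters_mono ih)

/-- The super-Lyndon-Shirshov `Ω`-monomials are the super-Lyndon-Shirshov monomials on a single
set of letters: the variables and the operators applied to such monomials. -/
theorem slsm_eq (par : X → ZMod 2) :
    slsm (X := X) ar par = slsOn par (opLetters (slsm ar par)) := by
  refine Set.Subset.antisymm (Set.iUnion_subset fun n => ?_) ?_
  · refine (slsmLevel_mono par n.le_succ).trans (slsOn_mono par (opLetters_mono ?_))
    exact Set.subset_iUnion (slsmLevel ar par) n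
  · refine (slsOn_mono par (opLetters_iUnion (slsmLevel_mono par))).trans ?_
    refine (slsOn_iUnion par fun _ _ h => opLetters_mono (slsmLevel_mono par h)).trans ?_
    exact Set.iUnion_subset fun n => Set.subset_iUnion (slsmLevel ar par) (n + 1)

theorem injOn_toWord_slsm (har : ∀ ω, 1 ≤ ar ω) (par : X → ZMod 2) :
    Set.InjOn toWord (slsm (X := X) ar par) := by
  have hlevel : ∀ n, Set.InjOn toWord (slsmLevel (X := X) ar par n) := by
    intro n
    induction n with
    | zero =>
      refine (injOn_toWord_slsOn har par (Set.injOn_empty _)).mono (slsOn_mono par ?_)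
      exact Set.subset_union_left
    | succ n ih => exact injOn_toWord_slsOn har par ih
  intro a ha b hb h
  obtain ⟨n, hn⟩ := Set.mem_iUnion.1 ha
  obtain ⟨n', hn'⟩ := Set.mem_iUnion.1 hb
  exact hlevel (max n n') (slsmLevel_mono par (le_max_left _ _) hn)
    (slsmLevel_mono par (le_max_right _ _) hn') h

end OmegaMonomial

/-! ### Leading words -/

section LeadingWord

variable {k : Type w} [Field k] {Ω : Type v} {ar : Ω → ℕ} {X : Type u}

theorem omegaWordMul_eq_sum (a b : OmegaWord ar X →₀ k) :
    omegaWordMul k ar a b = ∑ s ∈ a.support, ∑ t ∈ b.support,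
      Finsupp.single (s * t) (a s * b t) := by
  conv_lhs => rw [← Finsupp.sum_single a, ← Finsupp.sum_single b]
  simp only [Finsupp.sum, map_sum, LinearMap.sum_apply, omegaWordMul_single]
  exact Finset.sum_comm

theorem exists_of_omegaWordMul_ne_zero {a b : OmegaWord ar X →₀ k} {r : OmegaWord ar X}
    (h : omegaWordMul k ar a b r ≠ 0) : ∃ s t, a s ≠ 0 ∧ b t ≠ 0 ∧ s * t = r := by
  rw [omegaWordMul_eq_sum, Finsupp.finsetSum_apply] at h
  obtain ⟨s, hs, h⟩ := Finset.exists_ne_zero_of_sum_ne_zero h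
  rw [Finsupp.finsetSum_apply] at h
  obtain ⟨t, ht, h⟩ := Finset.exists_ne_zero_of_sum_ne_zero h
  refine ⟨s, t, Finsupp.mem_support_iff.1 hs, Finsupp.mem_support_iff.1 ht, ?_⟩
  by_contra hne
  exact h (Finsupp.single_eq_of_ne' hne)

theorem omegaWordMul_apply_mul {a b : OmegaWord ar X →₀ k} {u v : OmegaWord ar X}
    (h : ∀ s t, a s ≠ 0 → b t ≠ 0 → s * t = u * v → s = u ∧ t = v) :
    omegaWordMul k ar a b (u * v) = a u * b v := by
  rw [omegaWordMul_eq_sum, Finsupp.finsetSum_apply, Finset.sum_eq_single u,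
    Finsupp.finsetSum_apply, Finset.sum_eq_single v, Finsupp.single_eq_same]
  · intro t _ ht
    by_cases h0 : a u = 0 ∨ b t = 0
    · rcases h0 with h0 | h0 <;> simp [h0]
    · rw [not_or] at h0
      exact Finsupp.single_eq_of_ne' fun he => ht (h u t h0.1 h0.2 he).2
  · intro hv
    rw [Finsupp.notMem_support_iff.1 hv, mul_zero, Finsupp.single_zero, Finsupp.zero_apply]
  · intro s hs hsu
    rw [Finsupp.finsetSum_apply]
    refine Finset.sum_eq_zero fun t ht => Finsupp.single_eq_of_ne' fun he => hsu ?_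
    exact (h s t (Finsupp.mem_support_iff.1 hs) (Finsupp.mem_support_iff.1 ht) he).1
  · intro hu
    rw [Finsupp.finsetSum_apply]
    refine Finset.sum_eq_zero fun t _ => ?_
    rw [Finsupp.notMem_support_iff.1 hu, zero_mul, Finsupp.single_zero, Finsupp.zero_apply]

theorem omegaWordOp_eq_sum [DecidableEq (OmegaWord ar X)] (ω : Ω)
    (a : Fin (ar ω) → OmegaWord ar X →₀ k) :
    omegaWordOp k ar ω a = ∑ r ∈ Fintype.piFinset fun i => (a i).support,
      Finsupp.single (OmegaWord.single (OmegaPrime.op ω r)) (∏ i, a i (r i)) := by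
  have ha' : ∀ i, a i = ∑ s ∈ (a i).support, a i s • Finsupp.single s (1 : k) := by
    intro i
    conv_lhs => rw [← Finsupp.sum_single (a i)]
    simp [Finsupp.sum]
  conv_lhs => rw [funext ha', MultilinearMap.map_sum_finset]
  refine Finset.sum_congr rfl fun r _ => ?_
  rw [MultilinearMap.map_smul_univ, omegaWordOp_single, Finsupp.smul_single, smul_eq_mul, mul_one]

theorem exists_of_omegaWordOp_ne_zero {ω : Ω} {a : Fin (ar ω) → OmegaWord ar X →₀ k}
    {s : OmegaWord ar X} (h : omegaWordOp k ar ω a s ≠ 0) :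
    ∃ r : Fin (ar ω) → OmegaWord ar X, (∀ i, a i (r i) ≠ 0) ∧ s = .single (.op ω r) := by
  classical
  rw [omegaWordOp_eq_sum, Finsupp.finsetSum_apply] at h
  obtain ⟨r, hr, h⟩ := Finset.exists_ne_zero_of_sum_ne_zero h
  refine ⟨r, fun i => Finsupp.mem_support_iff.1 (Fintype.mem_piFinset.1 hr i), ?_⟩
  by_contra hne
  exact h (Finsupp.single_eq_of_ne hne)

theorem omegaWordOp_apply_single (ω : Ω) (a : Fin (ar ω) → OmegaWord ar X →₀ k)
    (r : Fin (ar ω) → OmegaWord ar X) :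
    omegaWordOp k ar ω a (.single (.op ω r)) = ∏ i, a i (r i) := by
  classical
  rw [omegaWordOp_eq_sum, Finsupp.finsetSum_apply, Finset.sum_eq_single r,
    Finsupp.single_eq_same]
  · intro s _ hs
    refine Finsupp.single_eq_of_ne' fun h => hs ?_
    simpa using h
  · intro hr
    simp only [Fintype.mem_piFinset, not_forall, Finsupp.notMem_support_iff] at hr
    obtain ⟨i, hi⟩ := hr
    rw [Finset.prod_eq_zero (Finset.mem_univ i) hi, Finsupp.single_zero, Finsupp.zero_apply]

theorem omegaLetter_mem (par : X → ZMod 2) (x : X) :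
    omegaLetter k ar x ∈ (freeAssocOmega k ar par).toLie.part (par x) :=
  Submodule.subset_span ⟨.single (.var x), by
    simp only [Set.mem_ofPred_eq, OmegaWord.parity, OmegaPrime.parity], rfl⟩

variable [LinearOrder X] [LinearOrder Ω]

/-- All words of `b` precede `w` in the Deg-lex order, and have its degree and breadth. -/
def IsBelow (b : OmegaWord ar X →₀ k) (w : OmegaWord ar X) : Prop :=
  ∀ s, b s ≠ 0 → s.deg = w.deg ∧ s.bre = w.bre ∧ OmegaWord.LexLT s w

/-- The word `w` occurs in `a`, and all other words of `a` precede `w` in the Deg-lex order and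
have its degree and breadth. -/
def IsLeading (a : OmegaWord ar X →₀ k) (w : OmegaWord ar X) : Prop :=
  a w ≠ 0 ∧ ∀ s, a s ≠ 0 → s.deg = w.deg ∧ s.bre = w.bre ∧ (s = w ∨ OmegaWord.LexLT s w)

theorem isLeading_single (w : OmegaWord ar X) : IsLeading (Finsupp.single w (1 : k)) w := by
  refine ⟨by simp, fun s hs => ?_⟩
  have : s = w := by
    by_contra h
    exact hs (Finsupp.single_eq_of_ne h)
  exact ⟨this ▸ rfl, this ▸ rfl, Or.inl this⟩

theorem IsLeading.isBelow {a : OmegaWord ar X →₀ k} {v w : OmegaWord ar X} (h : IsLeading a v)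
    (hd : v.deg = w.deg) (hb : v.bre = w.bre) (hvw : OmegaWord.LexLT v w) : IsBelow a w := by
  intro s hs
  obtain ⟨h1, h2, h3⟩ := h.2 s hs
  refine ⟨h1.trans hd, h2.trans hb, ?_⟩
  rcases h3 with rfl | h3
  · exact hvw
  · exact OmegaWord.LexLT.trans' _ _ _ h3 hvw

theorem IsLeading.sub_zsmul {a b : OmegaWord ar X →₀ k} {w : OmegaWord ar X} (ha : IsLeading a w)
    (hb : IsBelow b w) (n : ℤ) : IsLeading (a - n • b) w := by
  refine ⟨?_, fun s hs => ?_⟩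
  · have : b w = 0 := by
      by_contra h
      exact OmegaWord.LexLT.irrefl w (hb w h).2.2
    simpa [this] using ha.1
  · by_cases h : a s = 0
    · have : b s ≠ 0 := fun h' => hs (by simp [h, h'])
      exact ⟨(hb s this).1, (hb s this).2.1, Or.inr (hb s this).2.2⟩
    · exact ha.2 s h

theorem IsLeading.mul {a b : OmegaWord ar X →₀ k} {u v : OmegaWord ar X} (ha : IsLeading a u)
    (hb : IsLeading b v) : IsLeading (omegaWordMul k ar a b) (u * v) := by
  have key : ∀ s t, a s ≠ 0 → b t ≠ 0 → (s = u ∧ t = v) ∨ OmegaWord.LexLT (s * t) (u * v) := by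
    intro s t hs ht
    rcases (ha.2 s hs).2.2 with rfl | h
    · rcases (hb.2 t ht).2.2 with rfl | h'
      · exact Or.inl ⟨rfl, rfl⟩
      · exact Or.inr (h'.mul_left s)
    · exact Or.inr h.mul_right
  refine ⟨?_, fun r hr => ?_⟩
  · rw [omegaWordMul_apply_mul fun s t hs ht he => ?_]
    · exact mul_ne_zero ha.1 hb.1
    · exact (key s t hs ht).resolve_right (he ▸ OmegaWord.LexLT.irrefl _)
  · obtain ⟨s, t, hs, ht, rfl⟩ := exists_of_omegaWordMul_ne_zero hr
    refine ⟨?_, ?_, (key s t hs ht).imp_left fun h => by rw [h.1, h.2]⟩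
    · rw [OmegaWord.deg_mul, OmegaWord.deg_mul, (ha.2 s hs).1, (hb.2 t ht).1]
    · rw [OmegaWord.bre_mul, OmegaWord.bre_mul, (ha.2 s hs).2.1, (hb.2 t ht).2.1]

theorem IsLeading.op {ω : Ω} {a : Fin (ar ω) → OmegaWord ar X →₀ k}
    {r : Fin (ar ω) → OmegaWord ar X} (h : ∀ i, IsLeading (a i) (r i)) :
    IsLeading (omegaWordOp k ar ω a) (.single (.op ω r)) := by
  refine ⟨?_, fun s hs => ?_⟩
  · rw [omegaWordOp_apply_single]
    exact Finset.prod_ne_zero_iff.2 fun i _ => (h i).1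
  · obtain ⟨q, hq, rfl⟩ := exists_of_omegaWordOp_ne_zero hs
    have hd : (OmegaPrime.op ω q).deg = (OmegaPrime.op ω r).deg := by
      simp only [OmegaPrime.deg]
      rw [Finset.sum_congr rfl fun i _ => ((h i).2 _ (hq i)).1]
    refine ⟨by simpa only [OmegaWord.deg] using hd, rfl, ?_⟩
    by_cases hqr : q = r
    · exact Or.inl (hqr ▸ rfl)
    · obtain ⟨i, hi, hmin⟩ := WellFounded.has_min (wellFounded_lt (α := Fin (ar ω)))
        {i | q i ≠ r i} (Function.ne_iff.1 hqr)
      obtain ⟨h1, h2, h3⟩ := (h i).2 _ (hq i)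
      refine Or.inr (.single (.args i hd (fun j hj => ?_) (.lex h1 h2 (h3.resolve_left hi))))
      by_contra hne
      exact hmin j hne hj

/-- Elements with distinct leading words are linearly independent. -/
theorem linearIndependent_of_isLeading (har : ∀ ω, 1 ≤ ar ω) {ι : Type*}
    {a : ι → OmegaWord ar X →₀ k} {w : ι → OmegaWord ar X} (hw : Function.Injective w)
    (h : ∀ i, IsLeading (a i) (w i)) : LinearIndependent k a := by
  let := OmegaWord.degLexOrder (X := X) har
  rw [linearIndependent_iff]
  intro c hc
  by_contra hne
  obtain ⟨i, hi, hmax⟩ := c.support.exists_max_image w (Finsupp.support_nonempty_iff.2 hne)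
  have h0 := DFunLike.congr_fun hc (w i)
  rw [Finsupp.linearCombination_apply, Finsupp.sum, Finsupp.finsetSum_apply,
    Finset.sum_eq_single i, Finsupp.smul_apply, Finsupp.zero_apply, smul_eq_mul] at h0
  · exact mul_ne_zero (Finsupp.mem_support_iff.1 hi) (h i).1 h0
  · intro j hj hji
    rw [Finsupp.smul_apply]
    by_cases h1 : a j (w i) = 0
    · rw [h1, smul_zero]
    · obtain ⟨h2, h3, h4 | h4⟩ := (h j).2 _ h1
      · exact absurd (hw h4).symm hji
      · exact absurd (hmax j hj) (not_le.2 (OmegaWord.DegLexLT.lex h2 h3 h4))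
  · exact fun h => absurd hi h

end LeadingWord

namespace LieOmegaSuperalgebra

variable {k : Type w} {Ω : Type v} {ar : Ω → ℕ} {L : Type z}
  [Field k] [AddCommGroup L] [Module k L] {X : Type u}

theorem eval_mul (T : LieOmegaSuperalgebra k ar L) (f : X → L) (s t : OmegaMonomial ar X) :
    T.eval f (s * t) = T.bracket (T.eval f s) (T.eval f t) := by
  change T.eval f (.mul s t) = _
  rw [eval]

theorem eval_mem (T : LieOmegaSuperalgebra k ar L) {f : X → L} {par : X → ZMod 2}
    (hf : ∀ x, f x ∈ T.part (par x)) (m : OmegaMonomial ar X) :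
    T.eval f m ∈ T.part (m.toWord.parity par) := by
  induction m with
  | var x => simpa only [eval, OmegaMonomial.toWord, OmegaWord.parity, OmegaPrime.parity] using hf x
  | op ω a ih =>
    simp only [eval, OmegaMonomial.toWord, OmegaWord.parity, OmegaPrime.parity]
    exact T.op_mem ω _ _ ih
  | mul s t hs ht =>
    simp only [eval, OmegaMonomial.toWord, OmegaWord.parity_mul]
    exact T.bracket_mem _ _ _ _ hs ht

theorem eval_lift (T : LieOmegaSuperalgebra k ar L) (f : X → L) {S : Set (OmegaMonomial ar X)}
    (t : FreeMagma S) : T.eval f (FreeMagma.lift (fun a : S => a.1) t) =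
      T.treeEval (fun a : S => T.eval f a.1) t := by
  induction t with
  | ih1 a => rfl
  | ih2 s t hs ht => rw [map_mul, eval_mul, treeEval_mul, hs, ht]

end LieOmegaSuperalgebra

namespace OmegaMonomial

open SuperLyndon

variable {k : Type w} [Field k] {Ω : Type v} {ar : Ω → ℕ} {X : Type u}

theorem parity_toWord_lift (par : X → ZMod 2) {S : Set (OmegaMonomial ar X)} (t : FreeMagma S) :
    (FreeMagma.lift (fun a : S => a.1) t).toWord.parity par =
      ((word t).map fun a : S => a.1.toWord.parity par).sum := by
  induction t with
  | ih1 a => simp [word]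
  | ih2 s t hs ht =>
    rw [map_mul, word_mul, List.map_append, List.sum_append, ← hs, ← ht]
    exact OmegaWord.parity_mul par _ _

variable [LinearOrder X] [LinearOrder Ω]

theorem lexLT_of_lexGT {S : Set (OmegaMonomial ar X)} {p : S → OmegaPrime ar X}
    (hp : ∀ a : S, a.1.toWord = .single (p a)) {l l' : List S} (hl : l.length = l'.length)
    (h : LexGT (fun a b : S => OmegaWord.DegLexLT b.1.toWord a.1.toWord) l l')
    {s t : OmegaWord ar X} (hs : s.toList = l.map p) (ht : t.toList = l'.map p) :
    OmegaWord.LexLT t s := by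
  have hlt : ∀ a b : S, OmegaWord.DegLexLT b.1.toWord a.1.toWord →
      OmegaPrime.LT (p b) (p a) := by
    intro a b h
    rw [hp, hp] at h
    cases h with
    | deg h => exact .deg h
    | bre _ h => exact absurd h (lt_irrefl _)
    | lex _ _ h =>
      cases h with
      | single h => exact h
  induction l generalizing l' s t with
  | nil => exact absurd hs s.toList_ne_nil
  | cons a l ih =>
    cases l' with
    | nil => exact absurd ht t.toList_ne_nil
    | cons b l' =>
      rw [LexGT] at h
      cases s with
      | single q =>
        simp only [OmegaWord.toList, List.map_cons, List.cons.injEq] at hs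
        obtain rfl : l = [] := List.map_eq_nil_iff.1 hs.2.symm
        obtain rfl : l' = [] := List.length_eq_zero_iff.1 (by simpa using hl.symm)
        have h := h.resolve_right fun h => h.2
        obtain rfl : t = .single (p b) := OmegaWord.toList_injective ht
        rw [hs.1]
        exact .single (hlt a b h)
      | cons q s =>
        simp only [OmegaWord.toList, List.map_cons, List.cons.injEq] at hs
        cases t with
        | single q' =>
          simp only [OmegaWord.toList, List.map_cons, List.cons.injEq] at ht
          have h1 := congrArg List.length ht.2
          have h2 := List.length_pos_iff.2 s.toList_ne_nil
          rw [hs.2] at h2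
          simp only [List.length_map, List.length_nil, List.length_cons] at h1 h2 hl
          omega
        | cons q' t =>
          simp only [OmegaWord.toList, List.map_cons, List.cons.injEq] at ht
          rw [hs.1, ht.1]
          rcases h with h | ⟨rfl, h⟩
          · exact .head (hlt a b h)
          · exact .tail (ih (by simpa using hl) h hs.2 ht.2)

variable (par : X → ZMod 2)

theorem isLeading_eval_slsOn [CharZero k] {Y : Set (OmegaMonomial ar X)}
    (hY : ∀ m ∈ opLetters Y,
      IsLeading ((freeAssocOmega k ar par).toLie.eval (omegaLetter k ar) m) m.toWord)
    {m : OmegaMonomial ar X} (hm : m ∈ slsOn par (opLetters Y)) :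
    IsLeading ((freeAssocOmega k ar par).toLie.eval (omegaLetter k ar) m) m.toWord := by
  choose p hp using exists_toWord_eq_single (Y := Y)
  have hpart : ∀ m : OmegaMonomial ar X,
      (freeAssocOmega k ar par).toLie.eval (omegaLetter k ar) m ∈
        (freeAssocOmega k ar par).part (m.toWord.parity par) :=
    (freeAssocOmega k ar par).toLie.eval_mem (omegaLetter_mem par)
  have hbr : ∀ s t : OmegaMonomial ar X,
      (freeAssocOmega k ar par).toLie.eval (omegaLetter k ar) (s * t) =
        omegaWordMul k ar ((freeAssocOmega k ar par).toLie.eval (omegaLetter k ar) s)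
          ((freeAssocOmega k ar par).toLie.eval (omegaLetter k ar) t) -
        superSign (s.toWord.parity par) (t.toWord.parity par) •
        omegaWordMul k ar ((freeAssocOmega k ar par).toLie.eval (omegaLetter k ar) t)
          ((freeAssocOmega k ar par).toLie.eval (omegaLetter k ar) s) := fun s t => by
    rw [LieOmegaSuperalgebra.eval_mul]
    exact (freeAssocOmega k ar par).supercommutator_apply (hpart s) (hpart t)
  have hLS : ∀ t : FreeMagma (opLetters Y),
      IsLSMonomial (fun a b : opLetters Y => OmegaWord.DegLexLT b.1.toWord a.1.toWord) t →
      IsLeading ((freeAssocOmega k ar par).toLie.eval (omegaLetter k ar)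
        (FreeMagma.lift (fun a : opLetters Y => a.1) t))
        (FreeMagma.lift (fun a : opLetters Y => a.1) t).toWord := by
    intro t ht
    induction t with
    | ih1 a => exact hY a.1 a.2
    | ih2 s t ihs iht =>
      obtain ⟨h0, hs, ht, -⟩ := ht
      have h1 := ihs hs
      have h2 := iht ht
      have h3 := h0.2 (word s) (word t) (word_ne_nil s) (word_ne_nil t) rfl
      rw [map_mul, hbr]
      -- the Lyndon condition makes `s t` the larger of the two products
      refine (h1.mul h2).sub_zsmul ((h2.mul h1).isBelow ?_ ?_ (lexLT_of_lexGT hp ?_ h3 ?_ ?_)) _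
      · rw [OmegaWord.deg_mul, OmegaWord.deg_mul, add_comm]
      · rw [OmegaWord.bre_mul, OmegaWord.bre_mul, add_comm]
      · rw [List.length_append, List.length_append, add_comm]
      · rw [List.map_append, ← toList_toWord_lift hp, ← toList_toWord_lift hp]
        exact OmegaWord.toList_mul _ _
      · rw [List.map_append, ← toList_toWord_lift hp, ← toList_toWord_lift hp]
        exact OmegaWord.toList_mul _ _
  obtain ⟨t, ht | ⟨s, rfl, hs, hodd⟩, rfl⟩ := hm
  · exact hLS t ht
  · have h := (hLS s hs).mul (hLS s hs)
    rw [map_mul, hbr, parity_toWord_lift, hodd, show superSign 1 1 = -1 from rfl, neg_one_zsmul,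
      sub_neg_eq_add, ← two_smul k]
    refine ⟨?_, fun r hr => h.2 r fun h0 => hr ?_⟩
    · rw [Finsupp.smul_apply]
      exact smul_ne_zero two_ne_zero h.1
    · rw [Finsupp.smul_apply, h0, smul_zero]

theorem isLeading_eval_opLetters {Y : Set (OmegaMonomial ar X)}
    (hY : ∀ m ∈ Y,
      IsLeading ((freeAssocOmega k ar par).toLie.eval (omegaLetter k ar) m) m.toWord)
    {m : OmegaMonomial ar X} (hm : m ∈ opLetters Y) :
    IsLeading ((freeAssocOmega k ar par).toLie.eval (omegaLetter k ar) m) m.toWord := by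
  rcases hm with ⟨x, rfl⟩ | ⟨ω, a, ha, rfl⟩
  · exact isLeading_single _
  · simp only [toWord, LieOmegaSuperalgebra.eval]
    exact IsLeading.op fun i => hY _ (ha i)

/-- A super-Lyndon-Shirshov `Ω`-monomial, evaluated in the free associative `Ω`-superalgebra,
has its underlying word as leading word. -/
theorem isLeading_eval_slsm [CharZero k] {m : OmegaMonomial ar X} (hm : m ∈ slsm ar par) :
    IsLeading ((freeAssocOmega k ar par).toLie.eval (omegaLetter k ar) m) m.toWord := by
  obtain ⟨n, hn⟩ := Set.mem_iUnion.1 hm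
  clear hm
  induction n generalizing m with
  | zero =>
    refine isLeading_eval_slsOn par (Y := ∅)
      (fun _ h => isLeading_eval_opLetters par (fun _ h => absurd h (Set.notMem_empty _)) h)
      (slsOn_mono par Set.subset_union_left hn)
  | succ n ih =>
    exact isLeading_eval_slsOn par (fun _ h => isLeading_eval_opLetters par (fun _ h => ih h) h) hn

end OmegaMonomial

/-! ### The span of the super-Lyndon-Shirshov `Ω`-monomials -/

theorem MultilinearMap.map_mem_of_mem_span {R : Type*} [CommRing R] {ι : Type*} [Fintype ι]
    {M M' : Type*} [AddCommGroup M] [Module R M] [AddCommGroup M'] [Module R M']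
    (φ : MultilinearMap R (fun _ : ι => M) M') {s : Set M} {V : Submodule R M'}
    (h : ∀ b : ι → M, (∀ i, b i ∈ s) → φ b ∈ V) {a : ι → M}
    (ha : ∀ i, a i ∈ Submodule.span R s) : φ a ∈ V := by
  classical
  choose c hc using fun i => (Finsupp.mem_span_iff_linearCombination R s (a i)).1 (ha i)
  rw [show a = fun i => ∑ x ∈ (c i).support, c i x • (x : M) from
    funext fun i => by rw [← hc i, Finsupp.linearCombination_apply, Finsupp.sum],
    MultilinearMap.map_sum_finset]
  refine Submodule.sum_mem _ fun r _ => ?_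
  rw [MultilinearMap.map_smul_univ]
  exact V.smul_mem _ (h _ fun i => (r i).2)

namespace LieOmegaSuperalgebra

open SuperLyndon OmegaMonomial

variable {k : Type w} {Ω : Type v} {ar : Ω → ℕ} {L : Type z}
  [Field k] [AddCommGroup L] [Module k L] {X : Type u}

theorem image_eval_slsOn [LT X] [LT Ω] (T : LieOmegaSuperalgebra k ar L) (f : X → L)
    (par : X → ZMod 2) (S : Set (OmegaMonomial ar X)) :
    T.eval f '' slsOn par S = T.treeEval (fun a : S => T.eval f a.1) ''
      {t | IsSLSMonomial (fun a b : S => OmegaWord.DegLexLT b.1.toWord a.1.toWord)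
        (fun a => a.1.toWord.parity par) t} := by
  ext y
  constructor
  · rintro ⟨_, ⟨t, ht, rfl⟩, rfl⟩
    exact ⟨t, ht, (T.eval_lift f t).symm⟩
  · rintro ⟨t, ht, rfl⟩
    exact ⟨_, ⟨t, ht, rfl⟩, T.eval_lift f t⟩

section Span

variable [LinearOrder X] [LinearOrder Ω]

theorem proj_mem_span_eval_slsm (T : LieOmegaSuperalgebra k ar L)
    {f : X → L} {par : X → ZMod 2} (hf : ∀ x, f x ∈ T.part (par x)) (i : ZMod 2) {x : L}
    (hx : x ∈ Submodule.span k (T.eval f '' slsm ar par)) :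
    T.proj i x ∈ Submodule.span k (T.eval f '' slsm ar par) := by
  refine Submodule.span_induction (p := fun x _ =>
    T.proj i x ∈ Submodule.span k (T.eval f '' slsm ar par)) ?_ ?_ ?_ ?_ hx
  · rintro _ ⟨m, hm, rfl⟩
    by_cases h : i = m.toWord.parity par
    · rw [h, T.proj_self (T.eval_mem hf m)]
      exact Submodule.subset_span ⟨m, hm, rfl⟩
    · rw [T.proj_of_ne (T.eval_mem hf m) h]
      exact Submodule.zero_mem _
  · rw [map_zero]
    exact Submodule.zero_mem _
  · intro x y _ _ h1 h2
    rw [map_add]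
    exact Submodule.add_mem _ h1 h2
  · intro c x _ h
    rw [map_smul]
    exact Submodule.smul_mem _ c h

theorem bracket_mem_span_eval_slsm [CharZero k] (har : ∀ ω, 1 ≤ ar ω)
    (T : LieOmegaSuperalgebra k ar L)
    {f : X → L} {par : X → ZMod 2} (hf : ∀ x, f x ∈ T.part (par x)) {x y : L}
    (hx : x ∈ Submodule.span k (T.eval f '' slsm ar par))
    (hy : y ∈ Submodule.span k (T.eval f '' slsm ar par)) :
    T.bracket x y ∈ Submodule.span k (T.eval f '' slsm ar par) := by
  have heq := T.image_eval_slsOn f par (opLetters (slsm ar par))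
  rw [← slsm_eq par] at heq
  rw [heq] at hx hy ⊢
  let := letterOrder har (injOn_toWord_opLetters (injOn_toWord_slsm har par))
  exact T.bracket_mem_span_sls (α := opLetters (slsm ar par)) (g := fun a => T.eval f a.1)
    (par := fun a => a.1.toWord.parity par) (fun a => T.eval_mem hf a.1) hx hy

theorem opLetters_subset_slsm (har : ∀ ω, 1 ≤ ar ω) (par : X → ZMod 2) :
    opLetters (slsm (X := X) ar par) ⊆ slsm ar par := by
  intro m hm
  rw [slsm_eq par]
  refine ⟨.of ⟨m, hm⟩, Or.inl ?_, rfl⟩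
  let := letterOrder har (injOn_toWord_opLetters (injOn_toWord_slsm har par))
  exact isLSMonomial_of _

theorem op_mem_span_eval_slsm (har : ∀ ω, 1 ≤ ar ω) (T : LieOmegaSuperalgebra k ar L)
    (f : X → L) (par : X → ZMod 2) {ω : Ω} {a : Fin (ar ω) → L}
    (ha : ∀ i, a i ∈ Submodule.span k (T.eval f '' slsm ar par)) :
    T.op ω a ∈ Submodule.span k (T.eval f '' slsm ar par) := by
  refine (T.op ω).map_mem_of_mem_span (fun b hb => ?_) ha
  choose m hm hmb using hb
  rw [← funext hmb]
  exact Submodule.subset_span ⟨.op ω m,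
    opLetters_subset_slsm har par (Or.inr ⟨ω, m, hm, rfl⟩), by rw [eval]⟩

/-- In every Lie `Ω`-superalgebra the values of the super-Lyndon-Shirshov `Ω`-monomials span a
Lie `Ω`-sub-superalgebra. -/
theorem isSub_span_eval_slsm [CharZero k] (har : ∀ ω, 1 ≤ ar ω) (T : LieOmegaSuperalgebra k ar L)
    {f : X → L} {par : X → ZMod 2} (hf : ∀ x, f x ∈ T.part (par x)) :
    T.IsSub (Submodule.span k (T.eval f '' slsm ar par)) :=
  ⟨fun i _ hx => T.proj_mem_span_eval_slsm hf i hx,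
    fun _ _ hx hy => T.bracket_mem_span_eval_slsm har hf hx hy,
    fun _ _ ha => T.op_mem_span_eval_slsm har f par ha⟩

theorem var_mem_slsm (har : ∀ ω, 1 ≤ ar ω) (par : X → ZMod 2) (x : X) :
    (OmegaMonomial.var x : OmegaMonomial ar X) ∈ slsm ar par :=
  opLetters_subset_slsm har par (Or.inl ⟨x, rfl⟩)

end Span

theorem eval_restrict (T : LieOmegaSuperalgebra k ar L) {N : Submodule k L} (hN : T.IsSub N)
    (f : X → N) (m : OmegaMonomial ar X) :
    ((T.restrict hN).eval f m : L) = T.eval (fun x => (f x : L)) m := by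
  induction m with
  | var x => rfl
  | op ω a ih =>
    simp only [eval]
    rw [← funext ih]
    rfl
  | mul s t hs ht =>
    simp only [eval]
    rw [← hs, ← ht]
    rfl

theorem IsHom.map_eval {M : Type z'} [AddCommGroup M] [Module k M]
    {S : LieOmegaSuperalgebra k ar L} {T : LieOmegaSuperalgebra k ar M} {φ : L →ₗ[k] M}
    (h : S.IsHom T φ) (f : X → L) (m : OmegaMonomial ar X) :
    φ (S.eval f m) = T.eval (fun x => φ (f x)) m := by
  induction m with
  | var x => rfl
  | op ω a ih =>
    simp only [eval]
    rw [h.map_op, funext ih]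
  | mul s t hs ht =>
    simp only [eval]
    rw [h.map_bracket, hs, ht]

/-! ### Direct products and freeness -/

section Prod

variable {M : Type z'} [AddCommGroup M] [Module k M]

/-- The direct product of two Lie `Ω`-superalgebras, with componentwise operations. -/
noncomputable def prod (S : LieOmegaSuperalgebra k ar L) (T : LieOmegaSuperalgebra k ar M) :
    LieOmegaSuperalgebra k ar (L × M) where
  part i := (S.part i).prod (T.part i)
  isCompl := by
    constructor
    · rw [Submodule.disjoint_def]
      exact fun x h0 h1 => Prod.ext
        (Submodule.disjoint_def.1 S.isCompl.disjoint x.1 h0.1 h1.1)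
        (Submodule.disjoint_def.1 T.isCompl.disjoint x.2 h0.2 h1.2)
    · rw [codisjoint_iff, eq_top_iff]
      intro x _
      have hx : x = (S.proj 0 x.1, T.proj 0 x.2) + (S.proj 1 x.1, T.proj 1 x.2) :=
        Prod.ext (S.proj_add x.1).symm (T.proj_add x.2).symm
      rw [hx]
      exact Submodule.add_mem_sup ⟨S.proj_mem 0 x.1, T.proj_mem 0 x.2⟩
        ⟨S.proj_mem 1 x.1, T.proj_mem 1 x.2⟩
  op ω := ((S.op ω).compLinearMap fun _ => LinearMap.fst k L M).prod
    ((T.op ω).compLinearMap fun _ => LinearMap.snd k L M)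
  op_mem ω d a ha := ⟨S.op_mem ω d _ fun i => (ha i).1, T.op_mem ω d _ fun i => (ha i).2⟩
  bracket := LinearMap.mk₂ k (fun x y => (S.bracket x.1 y.1, T.bracket x.2 y.2))
    (fun _ _ _ => Prod.ext (by simp) (by simp)) (fun _ _ _ => Prod.ext (by simp) (by simp))
    (fun _ _ _ => Prod.ext (by simp) (by simp)) (fun _ _ _ => Prod.ext (by simp) (by simp))
  bracket_mem i j x y hx hy := ⟨S.bracket_mem i j _ _ hx.1 hy.1, T.bracket_mem i j _ _ hx.2 hy.2⟩
  skew i j x y hx hy := Prod.ext (S.skew i j _ _ hx.1 hy.1) (T.skew i j _ _ hx.2 hy.2)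
  jacobi i j l x y t hx hy ht := Prod.ext (S.jacobi i j l _ _ _ hx.1 hy.1 ht.1)
    (T.jacobi i j l _ _ _ hx.2 hy.2 ht.2)

theorem prod_proj (S : LieOmegaSuperalgebra k ar L) (T : LieOmegaSuperalgebra k ar M)
    (i : ZMod 2) (x : L × M) : (S.prod T).proj i x = (S.proj i x.1, T.proj i x.2) := by
  have hmem : ∀ j, (S.proj j x.1, T.proj j x.2) ∈ (S.prod T).part j :=
    fun j => ⟨S.proj_mem j x.1, T.proj_mem j x.2⟩
  have hx : x = (S.proj 0 x.1, T.proj 0 x.2) + (S.proj 1 x.1, T.proj 1 x.2) :=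
    Prod.ext (S.proj_add x.1).symm (T.proj_add x.2).symm
  have h01 : ∀ i : ZMod 2, i = 0 ∨ i = 1 := by decide
  conv_lhs => rw [hx, map_add]
  rcases h01 i with rfl | rfl
  · rw [(S.prod T).proj_self (hmem 0), (S.prod T).proj_of_ne (hmem 1) (by decide), add_zero]
  · rw [(S.prod T).proj_self (hmem 1), (S.prod T).proj_of_ne (hmem 0) (by decide), zero_add]

theorem prod_bracket (S : LieOmegaSuperalgebra k ar L) (T : LieOmegaSuperalgebra k ar M)
    (x y : L × M) : (S.prod T).bracket x y = (S.bracket x.1 y.1, T.bracket x.2 y.2) := rfl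

theorem prod_op (S : LieOmegaSuperalgebra k ar L) (T : LieOmegaSuperalgebra k ar M) (ω : Ω)
    (a : Fin (ar ω) → L × M) :
    (S.prod T).op ω a = (S.op ω fun i => (a i).1, T.op ω fun i => (a i).2) := rfl

theorem eval_prod (S : LieOmegaSuperalgebra k ar L) (T : LieOmegaSuperalgebra k ar M)
    (f : X → L) (g : X → M) (m : OmegaMonomial ar X) :
    (S.prod T).eval (fun x => (f x, g x)) m = (S.eval f m, T.eval g m) := by
  induction m with
  | var x => rfl
  | op ω a ih =>
    simp only [eval]
    rw [funext ih]
    rfl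
  | mul s t hs ht =>
    simp only [eval]
    rw [hs, ht]
    rfl

/-- A basis consisting of super-Lyndon-Shirshov `Ω`-monomials makes a Lie `Ω`-superalgebra free:
in the product with another Lie `Ω`-superalgebra, the span of these monomials is the graph of the
required homomorphism. -/
theorem isFreeOn_of_basis [CharZero k] [LinearOrder X] [LinearOrder Ω] (har : ∀ ω, 1 ≤ ar ω)
    (S : LieOmegaSuperalgebra k ar L) {par : X → ZMod 2} {ι : X → L}
    (hι : ∀ x, ι x ∈ S.part (par x))
    (hli : LinearIndependent k (fun m : slsm ar par => S.eval ι m.1))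
    (hsp : Submodule.span k (Set.range fun m : slsm ar par => S.eval ι m.1) = ⊤) :
    LieOmegaSuperalgebra.IsFreeOn.{u, v, w, z, z'} S par ι := by
  refine ⟨hι, fun M _ _ T f hf => ?_⟩
  let b := Module.Basis.mk hli hsp.ge
  let φ : L →ₗ[k] M := b.constr k fun m => T.eval f m.1
  have hφ : ∀ m ∈ slsm ar par, φ (S.eval ι m) = T.eval f m := by
    intro m hm
    have := b.constr_basis k (fun m => T.eval f m.1) ⟨m, hm⟩
    rwa [Module.Basis.mk_apply] at this
  let G : Submodule k (L × M) :=
    Submodule.span k ((S.prod T).eval (fun x => (ι x, f x)) '' slsm ar par)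
  have hG : (S.prod T).IsSub G :=
    isSub_span_eval_slsm har _ fun x => ⟨hι x, hf x⟩
  have hgraph : ∀ y ∈ G, φ y.1 = y.2 := by
    intro y hy
    suffices G ≤ LinearMap.eqLocus (φ ∘ₗ LinearMap.fst k L M) (LinearMap.snd k L M) from this hy
    refine Submodule.span_le.2 ?_
    rintro _ ⟨m, hm, rfl⟩
    rw [eval_prod]
    exact hφ m hm
  have hmem : ∀ x, (x, φ x) ∈ G := by
    intro x
    have hx : x ∈ Submodule.span k (Set.range fun m : slsm ar par => S.eval ι m.1) :=
      hsp ▸ Submodule.mem_top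
    suffices Submodule.span k (Set.range fun m : slsm ar par => S.eval ι m.1) ≤
      G.comap (LinearMap.id.prod φ) from this hx
    refine Submodule.span_le.2 ?_
    rintro _ ⟨m, rfl⟩
    refine Submodule.subset_span ⟨m.1, m.2, ?_⟩
    rw [eval_prod, ← hφ m.1 m.2]
    rfl
  refine ⟨φ, ⟨⟨fun i x hx => ?_, fun x y => ?_, fun ω a => ?_⟩, fun x => ?_⟩, ?_⟩
  · have hd : (S.prod T).proj i (x, φ x) = (x, T.proj i (φ x)) := by
      rw [prod_proj, S.proj_self hx]
    have := hgraph _ (hG.proj_mem i _ (hmem x))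
    rw [hd] at this
    exact this ▸ T.proj_mem i _
  · have := hgraph _ (hG.bracket_mem _ _ (hmem x) (hmem y))
    rwa [prod_bracket] at this
  · have := hgraph _ (hG.op_mem ω _ fun i => hmem (a i))
    rwa [prod_op] at this
  · simpa only [eval] using hφ _ (var_mem_slsm har par x)
  · rintro ψ ⟨hψ, hψx⟩
    refine b.ext fun m => ?_
    rw [Module.Basis.mk_apply, hψ.map_eval, hφ m.1 m.2, funext hψx]

end Prod

end LieOmegaSuperalgebra

theorem mainTheorem1 {k : Type w} [Field k] [CharZero k]
    {Ω : Type v} [LinearOrder Ω] [WellFoundedLT Ω] (ar : Ω → ℕ) (har : ∀ ω, 1 ≤ ar ω)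
    {X : Type u} [LinearOrder X] [WellFoundedLT X] (par : X → ZMod 2) :
    LieOmegaSuperalgebra.IsFreeOn.{u, v, w, max u v w, z'} (LSOmega.lie k ar par) par
      (LSOmega.letter k ar par) ∧
    LinearIndependent k (fun m : OmegaMonomial.slsm ar par =>
      (LSOmega.lie k ar par).eval (LSOmega.letter k ar par) m.1) ∧
    Submodule.span k (Set.range fun m : OmegaMonomial.slsm ar par =>
      (LSOmega.lie k ar par).eval (LSOmega.letter k ar par) m.1) = ⊤ := by
  have heval : ∀ m : OmegaMonomial ar X,
      ((LSOmega.lie k ar par).eval (LSOmega.letter k ar par) m : OmegaWord ar X →₀ k) =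
        (freeAssocOmega k ar par).toLie.eval (omegaLetter k ar) m :=
    LieOmegaSuperalgebra.eval_restrict _ _ _
  have hli : LinearIndependent k (fun m : OmegaMonomial.slsm ar par =>
      (LSOmega.lie k ar par).eval (LSOmega.letter k ar par) m.1) := by
    refine LinearIndependent.of_comp (LSOmega k ar par).subtype ?_
    refine linearIndependent_of_isLeading har (w := fun m => m.1.toWord)
      (OmegaMonomial.injOn_toWord_slsm har par).injective fun m => ?_
    change IsLeading ((LSOmega.lie k ar par).eval (LSOmega.letter k ar par) m.1).1 m.1.toWord
    rw [heval]
    exact OmegaMonomial.isLeading_eval_slsm par m.2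
  have hsp : Submodule.span k (Set.range fun m : OmegaMonomial.slsm ar par =>
      (LSOmega.lie k ar par).eval (LSOmega.letter k ar par) m.1) = ⊤ := by
    refine Submodule.map_injective_of_injective (LSOmega k ar par).injective_subtype ?_
    rw [Submodule.map_span, Submodule.map_top, Submodule.range_subtype]
    have hset : (LSOmega k ar par).subtype '' (Set.range fun m : OmegaMonomial.slsm ar par =>
        (LSOmega.lie k ar par).eval (LSOmega.letter k ar par) m.1) =
        (freeAssocOmega k ar par).toLie.eval (omegaLetter k ar) '' OmegaMonomial.slsm ar par := by
      rw [← Set.range_comp, Set.image_eq_range]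
      exact congrArg Set.range (funext fun m => heval m.1)
    refine le_antisymm (Submodule.span_le.2 ?_) ?_
    · rintro _ ⟨x, -, rfl⟩
      exact x.2
    · rw [hset]
      refine sInf_le ⟨?_, LieOmegaSuperalgebra.isSub_span_eval_slsm har _ (omegaLetter_mem par)⟩
      rintro _ ⟨x, rfl⟩
      exact Submodule.subset_span ⟨.var x, LieOmegaSuperalgebra.var_mem_slsm har par x, rfl⟩
  exact ⟨LieOmegaSuperalgebra.isFreeOn_of_basis har _ (fun x => omegaLetter_mem par x) hli hsp,
    hli, hsp⟩
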